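/- Let $K$ be a field. For a partition $\lambda$ let $s_\lambda(t_1,\dots,t_N)$ be the Schur polynomial in $N$ variables, i.e. the polynomial with integer coefficients determined by $s_\lambda(t)\cdot\det\bigl(t_i^{N-j}\bigr)_{1\le i,j\le N}=\det\bigl(t_i^{\lambda_j+N-j}\bigr)_{1\le i,j\le N}$ if $\lambda$ has at most $N$ parts, and $0$ otherwise. For a nonnegative integer $r$ let $\delta(r)=(r,r-1,\dots,2,1)$ be the staircase partition. For vectors $\boldsymbol{x},\boldsymbol{y},\dots$ the notation $s_\lambda(\boldsymbol{x},\boldsymbol{y},\dots)$ means that $s_\lambda$ is evaluated at the concatenated vector. If $0\le k\le m$ are integers, then $s_{\delta(k)}(t_1,\dots,t_m)$ is a nonzero polynomial (also after reduction of its coefficients to $K$), and the following hold for all integers $n\ge 0$. (1) Let $0\le k\le m$ be integers, and let $\boldsymbol{x}=(x_1,\dots,x_n)$, $\boldsymbol{y}=(y_1,\dots,y_n)$, $\boldsymbol{z}=(z_1,\dots,z_m)$ be vectors over $K$ with $x_i+y_j\ne 0$ for all $i,j$ and $s_{\delta(k)}(\boldsymbol{z})\ne 0$. Then $$\det\left(\frac{1}{x_i+y_j}\cdot\frac{s_{\delta(k)}(x_i,y_j,\boldsymbol{z})}{s_{\delta(k)}(\boldsymbol{z})}\right)_{1\le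 i,j\le n}=\frac{\prod_{1\le i<j\le n}(x_j-x_i)(y_j-y_i)}{\prod_{1\le i,j\le n}(x_i+y_j)}\cdot\frac{s_{\delta(k)}(\boldsymbol{x},\boldsymbol{y},\boldsymbol{z})}{s_{\delta(k)}(\boldsymbol{z})}.$$ (2) Let $0\le k\le m$ and $0\le l\le m'$ be integers, and let $\boldsymbol{x}=(x_1,\dots,x_{2n})$, $\boldsymbol{z}=(z_1,\dots,z_m)$, $\boldsymbol{w}=(w_1,\dots,w_{m'})$ be vectors over $K$ with $x_j+x_i\ne 0$ for $i<j$, $s_{\delta(k)}(\boldsymbol{z})\ne 0$ and $s_{\delta(l)}(\boldsymbol{w})\ne 0$. Then $$\operatorname{Pf}\left(\frac{x_j-x_i}{x_j+x_i}\cdot\frac{s_{\delta(k)}(x_i,x_j,\boldsymbol{z})}{s_{\delta(k)}(\boldsymbol{z})}\cdot\frac{s_{\delta(l)}(x_i,x_j,\boldsymbol{w})}{s_{\delta(l)}(\boldsymbol{w})}\right)_{1\le i,j\le 2n}=\prod_{1\le i<j\le 2n}\frac{x_j-x_i}{x_j+x_i}\cdot\frac{s_{\delta(k)}(\boldsymbol{x},\boldsymbol{z})}{s_{\delta(k)}(\boldsymbol{z})}\cdot\frac{s_{\delta(l)}(\boldsymbol{x},\boldsymbol{w})}{s_{\delta(l)}(\boldsymbol{w})},$$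 where the diagonal entries of the matrix are $0$. -/

import Mathlib

namespace PfaffianSchur

open MvPolynomial

section Alternants

variable {R : Type*} [CommRing R] {N : ℕ}

/-- The determinant `det (x_i ^ (a_j))` attached to exponents `a` and to `x_1, …, x_N`. -/
def alternant (a : Fin N → ℕ) (x : Fin N → R) : R :=
  (Matrix.of fun i j : Fin N => x i ^ a j).det

/-- The exponents `(N - 1, N - 2, …, 1, 0)`, whose alternant is the Vandermonde determinant. -/
def rhoExp (N : ℕ) : Fin N → ℕ := fun j => N - 1 - (j : ℕ)

/-- Every alternant is divisible by the Vandermonde determinant. -/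
theorem alternant_rhoExp_dvd (a : Fin N → ℕ) (x : Fin N → R) :
    alternant (rhoExp N) x ∣ alternant a x := by
  nontriviality R
  set P : Polynomial R := ∏ i, (Polynomial.X - Polynomial.C (x i)) with hP
  have hmonic : P.Monic := Polynomial.monic_prod_of_monic _ _
    fun i _ => Polynomial.monic_X_sub_C (x i)
  have hdeg : P.natDegree = N := by
    simp [hP, Polynomial.natDegree_prod_of_monic _ _
      fun i _ => Polynomial.monic_X_sub_C (x i)]
  have hroot (i : Fin N) : P.eval (x i) = 0 := by
    rw [hP, Polynomial.eval_prod]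
    exact Finset.prod_eq_zero (Finset.mem_univ i) (by simp)
  have key : (Matrix.of fun i j : Fin N => x i ^ a j) =
      (Matrix.of fun i j : Fin N => x i ^ rhoExp N j) *
        Matrix.of fun l j : Fin N =>
          ((Polynomial.X ^ a j : Polynomial R) %ₘ P).coeff (rhoExp N l) := by
    ext i j
    have h0 : ((Polynomial.X ^ a j : Polynomial R) %ₘ P).eval (x i) = x i ^ a j := by
      have := congrArg (Polynomial.eval (x i))
        (Polynomial.modByMonic_add_div (Polynomial.X ^ a j : Polynomial R) P)
      simpa [hroot] using this
    have hlt : ((Polynomial.X ^ a j : Polynomial R) %ₘ P).degree < N := by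
      have := Polynomial.degree_modByMonic_lt (Polynomial.X ^ a j : Polynomial R) hmonic
      rwa [Polynomial.degree_eq_natDegree hmonic.ne_zero, hdeg] at this
    have hsum : ((Polynomial.X ^ a j : Polynomial R) %ₘ P).eval (x i) =
        ∑ l : Fin N, ((Polynomial.X ^ a j : Polynomial R) %ₘ P).coeff l * x i ^ (l : ℕ) := by
      rw [Fin.sum_univ_eq_sum_range
        (fun l => ((Polynomial.X ^ a j : Polynomial R) %ₘ P).coeff l * x i ^ l) N]
      rcases eq_or_ne ((Polynomial.X ^ a j : Polynomial R) %ₘ P) 0 with h | h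
      · simp [h]
      · exact Polynomial.eval_eq_sum_range' ((Polynomial.natDegree_lt_iff_degree_lt h).2 hlt) _
    rw [Matrix.of_apply, Matrix.mul_apply, ← h0, hsum, ← Equiv.sum_comp Fin.revPerm]
    refine Finset.sum_congr rfl fun l _ => ?_
    have hl : ((Fin.revPerm l : Fin N) : ℕ) = rhoExp N l := by
      simp only [Fin.revPerm_apply, Fin.val_rev, rhoExp]; omega
    rw [hl, Matrix.of_apply, Matrix.of_apply, mul_comm]
  rw [alternant, alternant, key, Matrix.det_mul]
  exact dvd_mul_right _ _

end Alternants

/-- The polynomial `s` with `s * det (X_i ^ (N - j)) = det (X_i ^ (λ_j + N - j))`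
(indices from `1` to `N`); it is unique, as the Vandermonde determinant is not zero. -/
noncomputable def bialternant (lam : YoungDiagram) (N : ℕ) : MvPolynomial (Fin N) ℤ :=
  Classical.choose (alternant_rhoExp_dvd (fun j : Fin N => lam.rowLen j + rhoExp N j)
    (X : Fin N → MvPolynomial (Fin N) ℤ))

theorem bialternant_spec (lam : YoungDiagram) (N : ℕ) :
    alternant (fun j : Fin N => lam.rowLen j + rhoExp N j)
        (X : Fin N → MvPolynomial (Fin N) ℤ) =
      alternant (rhoExp N) X * bialternant lam N :=
  Classical.choose_spec (alternant_rhoExp_dvd (fun j : Fin N => lam.rowLen j + rhoExp N j)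
    (X : Fin N → MvPolynomial (Fin N) ℤ))

/-- The Schur polynomial `s_λ(X_1, …, X_N)`: the quotient of alternants if the partition `λ` has
at most `N` parts, and `0` otherwise. -/
noncomputable def schurPoly (lam : YoungDiagram) (N : ℕ) : MvPolynomial (Fin N) ℤ :=
  if lam.colLen 0 ≤ N then bialternant lam N else 0

/-- The value `s_λ(v_1, …, v_N)` of the Schur polynomial. -/
noncomputable def schur {R : Type*} [CommRing R] (lam : YoungDiagram) {N : ℕ} (v : Fin N → R) : R :=
  aeval v (schurPoly lam N)

/-- The staircase partition `δ(r) = (r, r - 1, …, 2, 1)`. -/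
def staircase (r : ℕ) : YoungDiagram where
  cells := (Finset.range r ×ˢ Finset.range r).filter fun c => c.1 + c.2 < r
  isLowerSet := by
    rintro ⟨a, b⟩ ⟨c, d⟩ h hab
    have h1 : c ≤ a := h.1
    have h2 : d ≤ b := h.2
    simp only [Finset.coe_filter, Finset.mem_product, Finset.mem_range, Set.mem_ofPred_eq] at hab ⊢
    omega

theorem mem_staircase (r i j : ℕ) : (i, j) ∈ staircase r ↔ i + j < r := by
  rw [← YoungDiagram.mem_cells]
  simp only [staircase, Finset.mem_filter, Finset.mem_product, Finset.mem_range]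
  omega

theorem staircase_rowLen (r i : ℕ) : (staircase r).rowLen i = r - i := by
  refine eq_of_forall_lt_iff fun j => ?_
  rw [← YoungDiagram.mem_iff_lt_rowLen, mem_staircase]
  omega

theorem staircase_colLen (r j : ℕ) : (staircase r).colLen j = r - j := by
  refine eq_of_forall_lt_iff fun i => ?_
  rw [← YoungDiagram.mem_iff_lt_colLen, mem_staircase]
  omega

/-- The Pfaffian of a skew-symmetric matrix of size `2n`: the sum over the perfect matchings
`{σ(1), σ(2)}, {σ(3), σ(4)}, …` of `{1, …, 2n}`, each listed once, with
`σ(2i-1) < σ(2i)` and `σ(1) < σ(3) < … < σ(2n-1)`, of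
`sgn(σ) a_{σ(1)σ(2)} a_{σ(3)σ(4)} ⋯ a_{σ(2n-1)σ(2n)}`. -/
def pfaffian {R : Type*} [CommRing R] {n : ℕ} (A : Matrix (Fin (2 * n)) (Fin (2 * n)) R) : R :=
  ∑ σ : Equiv.Perm (Fin (2 * n)) with
      (∀ i : Fin n, σ ⟨2 * i, by omega⟩ < σ ⟨2 * i + 1, by omega⟩) ∧
      (∀ i j : Fin n, i < j → σ ⟨2 * i, by omega⟩ < σ ⟨2 * j, by omega⟩),
    ((Equiv.Perm.sign σ : ℤ) : R) *
      ∏ i : Fin n, A (σ ⟨2 * i, by omega⟩) (σ ⟨2 * i + 1, by omega⟩)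

end PfaffianSchur

/-!
The proof reduces both identities to determinants of one shape. For nodes `u_i` and vectors
`h_i = (h_i(0), h_i(1))` let `pairDet u h` be the determinant with rows
`h_i(0), h_i(1), u_i h_i(0), u_i h_i(1), u_i² h_i(0), …`.

*Reduction.* The exponents in the numerator of `s_{δ(k)}` in `m + p` variables, `p` even, are
`0, …, p - 1` together with the exponents `e_j` for `m` variables shifted by `p`, and adding two to
an exponent does not leave this set. If `s_{δ(k)}(z) ≠ 0` and `z` is generic, there are functions
`h_q(t) = t^q - ∑_j a_{qj} t^{e_j + 2}` for `q = 0, 1` that vanish at all `z_c`. A unitriangular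
change of columns replaces `1, t, …, t^{p-1}` by `h_0, h_1, t² h_0, t² h_1, …`, and the numerator
splits off the numerator for `z` alone. So, up to the Vandermonde determinant of `x` and factors
absorbed into `h`, the quotient `s_{δ(k)}(x, z) / s_{δ(k)}(z)` is `pairDet` of the `x_i²` and the
`h(x_i)`, for all even lengths of `x` with the same `h` (`exists_schur_append_eq_pairDet`).

*The two evaluations.* With `d_h(i, j) = h_i(0) h_j(1) - h_j(0) h_i(1)`, which is the `pairDet` of
size two, it remains to evaluate `det (d(x_i, y_j) / (v_j - u_i))` as a single `pairDet`
(`det_cauchy_pairDet`) and `Pf (d_h(i, j) d_g(i, j) / (u_j - u_i))` as a product of two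
(`pfaffian_pairDet`). Both go by induction, expanding along the first row. As a function of the
first node `u_0` alone, with `h_0` fixed, the right hand side is a polynomial whose degree is
smaller than the number of the other nodes occurring in the expansion, so it is given by Lagrange
interpolation at these nodes. At `u_0 = u_j` the determinant factors through the one with rows `0`
and `j` deleted (`pairDet_of_eq`), and the interpolation formula is the row expansion.

*Specialization.* After multiplication by all denominators the identities say that `detDefect` and
`pfDefect` vanish. These are polynomials with integer coefficients in the entries of the vectors,
so it is enough to treat the generic point, where all the genericity conditions used above hold.
-/

namespace PfaffianSchur

/-! ### Expansion of the Pfaffian along the first row -/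

section Pfaffian

variable {R S : Type*} [CommRing R] [CommRing S]

/-- The permutation of `Fin (N + 2)` whose values are `0`, then `j + 1`, then the remaining
elements in increasing order, rearranged by `τ`. -/
def matchingPerm {N : ℕ} (j : Fin (N + 1)) (τ : Equiv.Perm (Fin N)) :
    Equiv.Perm (Fin (N + 2)) :=
  Equiv.Perm.decomposeFin.symm (0, j.cycleRange.symm * Equiv.Perm.decomposeFin.symm (0, τ))

theorem matchingPerm_zero {N : ℕ} (j : Fin (N + 1)) (τ : Equiv.Perm (Fin N)) :
    matchingPerm j τ 0 = 0 := by
  simp [matchingPerm]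

theorem matchingPerm_one {N : ℕ} (j : Fin (N + 1)) (τ : Equiv.Perm (Fin N)) :
    matchingPerm j τ (Fin.succ 0) = j.succ := by
  rw [matchingPerm, Equiv.Perm.decomposeFin_symm_apply_succ]
  simp

theorem matchingPerm_succ_succ {N : ℕ} (j : Fin (N + 1)) (τ : Equiv.Perm (Fin N)) (i : Fin N) :
    matchingPerm j τ i.succ.succ = (j.succAbove (τ i)).succ := by
  rw [matchingPerm, Equiv.Perm.decomposeFin_symm_apply_succ]
  simp

theorem sign_matchingPerm {N : ℕ} (j : Fin (N + 1)) (τ : Equiv.Perm (Fin N)) :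
    Equiv.Perm.sign (matchingPerm j τ) = (-1) ^ (j : ℕ) * Equiv.Perm.sign τ := by
  simp [matchingPerm, Fin.sign_cycleRange]

theorem matchingPerm_injective {N : ℕ} {j j' : Fin (N + 1)} {τ τ' : Equiv.Perm (Fin N)}
    (h : matchingPerm j τ = matchingPerm j' τ') : j = j' ∧ τ = τ' := by
  have hj : j = j' := by
    have := congrArg (fun σ => σ (Fin.succ 0)) h
    simpa only [matchingPerm_one, Fin.succ_inj] using this
  subst hj
  refine ⟨rfl, Equiv.ext fun i => ?_⟩
  have := congrArg (fun σ => σ i.succ.succ) h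
  simpa only [matchingPerm_succ_succ, Fin.succ_inj, Fin.succAbove_right_inj] using this

theorem exists_eq_matchingPerm {N : ℕ} (σ : Equiv.Perm (Fin (N + 2))) (h : σ 0 = 0) :
    ∃ j τ, matchingPerm j τ = σ := by
  have key : ∀ {M : ℕ} (ρ : Equiv.Perm (Fin (M + 1))), ρ 0 = 0 →
      ∃ τ, Equiv.Perm.decomposeFin.symm (0, τ) = ρ := by
    intro M ρ hρ
    refine ⟨(Equiv.Perm.decomposeFin ρ).2, ?_⟩
    have : (Equiv.Perm.decomposeFin ρ).1 = 0 := by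
      rw [← hρ, ← Equiv.Perm.decomposeFin_symm_apply_zero (Equiv.Perm.decomposeFin ρ).1
        (Equiv.Perm.decomposeFin ρ).2]
      simp
    rw [← this]
    simp
  obtain ⟨ρ, rfl⟩ := key σ h
  obtain ⟨τ, hτ⟩ := key ((ρ 0).cycleRange * ρ) (by simp)
  exact ⟨ρ 0, τ, by rw [matchingPerm, hτ, ← mul_assoc]; simp [← Equiv.Perm.inv_def]⟩

/-- The condition on a permutation, in the definition of `pfaffian`, to list a perfect matching in
its normal form. -/
def IsMatching {n N : ℕ} (hN : N = 2 * n) (σ : Equiv.Perm (Fin N)) : Prop :=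
  (∀ i : Fin n, σ ⟨2 * i, by omega⟩ < σ ⟨2 * i + 1, by omega⟩) ∧
    ∀ i j : Fin n, i < j → σ ⟨2 * i, by omega⟩ < σ ⟨2 * j, by omega⟩

instance {n N : ℕ} (hN : N = 2 * n) : DecidablePred (IsMatching hN) := fun σ => by
  unfold IsMatching; infer_instance

theorem matchingPerm_even {n : ℕ} (j : Fin (2 * n + 1)) (τ : Equiv.Perm (Fin (2 * n)))
    (i : Fin n) (hi : 2 * (i.succ : ℕ) < 2 * n + 2) :
    matchingPerm j τ ⟨2 * (i.succ : ℕ), hi⟩ = (j.succAbove (τ ⟨2 * i, by omega⟩)).succ := by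
  rw [← matchingPerm_succ_succ]
  rfl

theorem matchingPerm_odd {n : ℕ} (j : Fin (2 * n + 1)) (τ : Equiv.Perm (Fin (2 * n)))
    (i : Fin n) (hi : 2 * (i.succ : ℕ) + 1 < 2 * n + 2) :
    matchingPerm j τ ⟨2 * (i.succ : ℕ) + 1, hi⟩ =
      (j.succAbove (τ ⟨2 * i + 1, by omega⟩)).succ := by
  rw [← matchingPerm_succ_succ]
  rfl

theorem isMatching_matchingPerm {n : ℕ} (j : Fin (2 * n + 1)) (τ : Equiv.Perm (Fin (2 * n))) :
    IsMatching (n := n + 1) (by ring) (matchingPerm j τ) ↔ IsMatching rfl τ := by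
  have h0 : ∀ h, matchingPerm j τ ⟨2 * ((0 : Fin (n + 1)) : ℕ), h⟩ = 0 :=
    fun _ => matchingPerm_zero j τ
  have h1 : ∀ h, matchingPerm j τ ⟨2 * ((0 : Fin (n + 1)) : ℕ) + 1, h⟩ = j.succ :=
    fun _ => matchingPerm_one j τ
  simp only [IsMatching, Fin.forall_fin_succ, h0, h1, matchingPerm_even, matchingPerm_odd,
    Fin.succ_pos, Fin.succ_lt_succ_iff, Fin.succAbove_lt_succAbove_iff, Fin.not_lt_zero,
    false_imp_iff, imp_true_iff, true_and]

theorem IsMatching.apply_zero {n N : ℕ} {hN : N + 1 = 2 * (n + 1)}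
    {σ : Equiv.Perm (Fin (N + 1))} (hσ : IsMatching hN σ) : σ 0 = 0 := by
  obtain ⟨c, hc⟩ := σ.surjective 0
  rcases Nat.even_or_odd' (c : ℕ) with ⟨i, hi | hi⟩
  · by_cases hi0 : i = 0
    · have : c = 0 := Fin.ext (by simp [hi, hi0])
      rwa [this] at hc
    · have h := hσ.2 0 ⟨i, by omega⟩ (by rw [Fin.lt_def]; simp; omega)
      have hc' : c = ⟨2 * i, by omega⟩ := Fin.ext hi
      rw [← hc', hc] at h
      exact absurd h (Fin.not_lt_zero _)
  · have h := hσ.1 ⟨i, by omega⟩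
    have hc' : c = ⟨2 * i + 1, by omega⟩ := Fin.ext hi
    rw [← hc', hc] at h
    exact absurd h (Fin.not_lt_zero _)

/-- Expansion along the first row: the sum runs over the partner `j + 1` of `0`. -/
theorem pfaffian_succ {n : ℕ} (A : Matrix (Fin (2 * n + 2)) (Fin (2 * n + 2)) R) :
    pfaffian (n := n + 1) A = ∑ j : Fin (2 * n + 1), (-1) ^ (j : ℕ) * A 0 j.succ *
      pfaffian (A.submatrix (fun i => (j.succAbove i).succ) (fun i => (j.succAbove i).succ)) := by
  suffices main : ∑ σ : Equiv.Perm (Fin (2 * n + 2)) with IsMatching (n := n + 1) (by ring) σ,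
      ((Equiv.Perm.sign σ : ℤ) : R) * ∏ i : Fin (n + 1),
        A (σ ⟨2 * i, by omega⟩) (σ ⟨2 * i + 1, by omega⟩) =
      ∑ j : Fin (2 * n + 1), (-1) ^ (j : ℕ) * A 0 j.succ *
        ∑ τ : Equiv.Perm (Fin (2 * n)) with IsMatching rfl τ,
          ((Equiv.Perm.sign τ : ℤ) : R) * ∏ i : Fin n,
            A (j.succAbove (τ ⟨2 * i, by omega⟩)).succ
              (j.succAbove (τ ⟨2 * i + 1, by omega⟩)).succ by
    exact main
  simp_rw [Finset.mul_sum]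
  rw [Finset.sum_sigma']
  symm
  refine Finset.sum_nbij (fun p => matchingPerm p.1 p.2) ?_ ?_ ?_ ?_
  · rintro ⟨j, τ⟩ h
    simp only [Finset.mem_sigma, Finset.mem_univ, Finset.mem_filter, true_and] at h ⊢
    exact (isMatching_matchingPerm j τ).2 h
  · rintro ⟨j, τ⟩ _ ⟨j', τ'⟩ _ h
    obtain ⟨rfl, rfl⟩ := matchingPerm_injective h
    rfl
  · intro σ hσ
    simp only [Finset.coe_filter, Finset.mem_univ, true_and, Set.mem_ofPred_eq] at hσ
    obtain ⟨j, τ, rfl⟩ := exists_eq_matchingPerm σ hσ.apply_zero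
    refine ⟨⟨j, τ⟩, ?_, rfl⟩
    simp only [Finset.coe_sigma, Finset.coe_univ, Set.mem_sigma_iff, Set.mem_univ, true_and,
      Finset.coe_filter, Finset.mem_univ, Set.mem_ofPred_eq]
    exact (isMatching_matchingPerm j τ).1 hσ
  · rintro ⟨j, τ⟩ _
    have h0 : ∀ h, matchingPerm j τ ⟨2 * ((0 : Fin (n + 1)) : ℕ), h⟩ = 0 :=
      fun _ => matchingPerm_zero j τ
    have h1 : ∀ h, matchingPerm j τ ⟨2 * ((0 : Fin (n + 1)) : ℕ) + 1, h⟩ = j.succ :=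
      fun _ => matchingPerm_one j τ
    simp only [Fin.prod_univ_succ, h0, h1, matchingPerm_even, matchingPerm_odd,
      sign_matchingPerm]
    push_cast
    ring

theorem pfaffian_zero (A : Matrix (Fin (2 * 0)) (Fin (2 * 0)) R) : pfaffian A = 1 := by
  rw [pfaffian, Finset.sum_eq_single_of_mem 1]
  · simp
  · simp
  · intro σ _ h
    exact absurd (Equiv.ext fun i => i.elim0) h

/-- The Pfaffian only involves the entries above the diagonal. -/
theorem pfaffian_congr {n : ℕ} {A B : Matrix (Fin (2 * n)) (Fin (2 * n)) R}
    (h : ∀ i j, i < j → A i j = B i j) : pfaffian A = pfaffian B := by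
  refine Finset.sum_congr rfl fun σ hσ => ?_
  rw [Finset.mem_filter] at hσ
  congr 1
  exact Finset.prod_congr rfl fun i _ => h _ _ (hσ.2.1 i)

theorem pfaffian_const_mul {n : ℕ} (c : R) (A : Matrix (Fin (2 * n)) (Fin (2 * n)) R) :
    pfaffian (Matrix.of fun i j => c * A i j) = c ^ n * pfaffian A := by
  simp only [pfaffian, Matrix.of_apply, Finset.prod_mul_distrib, Finset.mul_sum,
    Finset.prod_const, Finset.card_univ, Fintype.card_fin]
  exact Finset.sum_congr rfl fun σ _ => by ring

theorem map_pfaffian {n : ℕ} (f : R →+* S) (A : Matrix (Fin (2 * n)) (Fin (2 * n)) R) :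
    f (pfaffian A) = pfaffian (A.map f) := by
  simp [pfaffian, map_sum, map_mul, map_prod]

end Pfaffian

/-! ### Vandermonde determinants -/

section Vandermonde

open Matrix

variable {R : Type*} [CommRing R]

theorem det_vandermonde_succ {N : ℕ} (v : Fin (N + 1) → R) :
    (vandermonde v).det =
      (∏ i : Fin N, (v i.succ - v 0)) * (vandermonde fun i => v (Fin.succ i)).det := by
  rw [det_vandermonde, det_vandermonde, Fin.prod_univ_succ, Fin.prod_Ioi_zero]
  simp_rw [Fin.prod_Ioi_succ]

/-- Splitting off an arbitrary point from a Vandermonde determinant. -/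
theorem det_vandermonde_succAbove {N : ℕ} (v : Fin (N + 1) → R) (j : Fin (N + 1)) :
    (vandermonde v).det = (-1) ^ (j : ℕ) * (∏ i : Fin N, (v (j.succAbove i) - v j)) *
      (vandermonde fun i => v (j.succAbove i)).det := by
  have h := det_permute j.cycleRange.symm (vandermonde v)
  have h2 : (vandermonde v).submatrix j.cycleRange.symm id =
      vandermonde fun i => v (j.cycleRange.symm i) := rfl
  rw [h2, det_vandermonde_succ] at h
  simp only [Fin.cycleRange_symm_succ, Fin.cycleRange_symm_zero, Equiv.Perm.sign_symm,
    Fin.sign_cycleRange] at h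
  push_cast at h
  rw [mul_assoc, h, ← mul_assoc, ← pow_add, Even.neg_one_pow ⟨_, rfl⟩, one_mul]

theorem det_vandermonde_append {p q : ℕ} (x : Fin p → R) (z : Fin q → R) :
    (vandermonde (Fin.append x z)).det = (vandermonde x).det * (vandermonde z).det *
      ∏ i, ∏ c, (z c - x i) := by
  have hI : ∀ {N : ℕ} (v : Fin N → R), (vandermonde v).det =
      ∏ i, ∏ j, if i < j then v j - v i else 1 := by
    intro N v
    rw [det_vandermonde]
    refine Finset.prod_congr rfl fun i _ => ?_
    rw [← Finset.prod_filter]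
    congr 1
    ext j
    simp
  have h1 : ∀ (i : Fin p) (j : Fin q), Fin.castAdd q i < Fin.natAdd p j := fun i j => by
    simp only [Fin.lt_def, Fin.val_castAdd, Fin.val_natAdd]; omega
  have h2 : ∀ (i : Fin p) (j : Fin q), ¬ Fin.natAdd p j < Fin.castAdd q i := fun i j => by
    simp only [Fin.lt_def, Fin.val_castAdd, Fin.val_natAdd]; omega
  have h3 : ∀ (i j : Fin p), Fin.castAdd q i < Fin.castAdd q j ↔ i < j := fun i j => Iff.rfl
  have h4 : ∀ (i j : Fin q), Fin.natAdd p i < Fin.natAdd p j ↔ i < j := fun i j => by simp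
  rw [hI, hI, hI, Fin.prod_univ_add]
  simp only [Fin.prod_univ_add, Fin.append_left, Fin.append_right, h1, h2, h3, h4, if_true,
    if_false, Finset.prod_const_one, one_mul, Finset.prod_mul_distrib]
  ring

end Vandermonde

/-! ### Two-column Vandermonde determinants -/

section PairDet

variable {K : Type*} [Field K]

/-- The determinant whose `i`-th row is `h_i(0), h_i(1), u_i h_i(0), u_i h_i(1), u_i² h_i(0), …`,
with as many columns as there are rows. The vector `h_i` of length two is a function on `ℕ` of
which only the values at `0` and `1` matter. -/
def pairDet {R : Type*} [CommRing R] {N : ℕ} (u : Fin N → R) (h : Fin N → ℕ → R) : R :=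
  (Matrix.of fun i c : Fin N => u i ^ ((c : ℕ) / 2) * h i ((c : ℕ) % 2)).det

theorem pairDet_two {R : Type*} [CommRing R] (u : Fin 2 → R) (h : Fin 2 → ℕ → R) :
    pairDet u h = h 0 0 * h 1 1 - h 1 0 * h 0 1 := by
  simp [pairDet, Matrix.det_fin_two]
  ring

theorem pairDet_mul {R : Type*} [CommRing R] {N : ℕ} (u : Fin N → R) (c : Fin N → R)
    (h : Fin N → ℕ → R) :
    pairDet u (fun i p => c i * h i p) = (∏ i, c i) * pairDet u h := by
  rw [pairDet, pairDet, ← Matrix.det_mul_column]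
  congr 1
  ext i j
  simp only [Matrix.of_apply]
  ring

/-- If two rows share the same `u`, the determinant factors: clearing `u` from these two rows by
column operations leaves a block triangular matrix. -/
theorem pairDet_of_eq {R : Type*} [CommRing R] {N : ℕ} (u : Fin (N + 2) → R)
    (h : Fin (N + 2) → ℕ → R)
    (j : Fin (N + 1)) (hj : u 0 = u j.succ) :
    pairDet u h = (-1) ^ (j : ℕ) * (h 0 0 * h j.succ 1 - h j.succ 0 * h 0 1) *
      (∏ i : Fin N, (u (j.succAbove i).succ - u j.succ)) *
      pairDet (fun i : Fin N => u (j.succAbove i).succ) (fun i => h (j.succAbove i).succ) := by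
  set a := u j.succ with ha
  set A : Matrix (Fin (N + 2)) (Fin (N + 2)) R :=
    Matrix.of fun i c => u i ^ ((c : ℕ) / 2) * h i ((c : ℕ) % 2) with hA
  set B : Matrix (Fin (N + 2)) (Fin (N + 2)) R :=
    Matrix.of fun c' c => if c' = c then 1 else if (c' : ℕ) + 2 = c then -a else 0 with hB
  have hdetB : B.det = 1 := by
    rw [Matrix.det_of_isUpperTriangular]
    · simp [hB]
    · intro c' c hlt
      simp only [id] at hlt
      have : c' ≠ c := ne_of_gt hlt
      have h2 : (c' : ℕ) + 2 ≠ c := by rw [Fin.lt_def] at hlt; omega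
      simp [hB, this, h2]
  set C := A * B with hC
  have hC0 : ∀ i, C i 0 = h i 0 := by
    intro i
    rw [hC, Matrix.mul_apply, Finset.sum_eq_single 0]
    · simp [hA, hB]
    · intro c _ hc
      simp [hB, hc]
    · simp
  have hC1 : ∀ i, C i (Fin.succ 0) = h i 1 := by
    intro i
    rw [hC, Matrix.mul_apply, Finset.sum_eq_single (Fin.succ 0)]
    · simp [hA, hB]
    · intro c _ hc
      have : (c : ℕ) + 2 ≠ ((Fin.succ 0 : Fin (N + 2)) : ℕ) := by simp
      simp only [hB, Matrix.of_apply, hc, this, if_false, mul_zero]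
    · simp
  have hC2 : ∀ i (c : Fin N), C i c.succ.succ =
      (u i - a) * (u i ^ ((c : ℕ) / 2) * h i ((c : ℕ) % 2)) := by
    intro i c
    have hne : c.castSucc.castSucc ≠ c.succ.succ := by
      intro h; have := congrArg Fin.val h; simp at this; omega
    rw [hC, Matrix.mul_apply, Finset.sum_eq_add c.succ.succ c.castSucc.castSucc hne.symm]
    · have h1 : ((c : ℕ) + 1 + 1) / 2 = (c : ℕ) / 2 + 1 := by omega
      have h2 : ((c : ℕ) + 1 + 1) % 2 = (c : ℕ) % 2 := by omega
      simp only [hA, hB, Matrix.of_apply, if_true, hne, if_false, Fin.val_succ,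
        Fin.val_castSucc, h1, h2]
      ring
    · intro c' _ hc'
      have : (c' : ℕ) + 2 ≠ (c.succ.succ : ℕ) := by
        intro h
        exact hc'.2 (Fin.ext (by simp at h ⊢; omega))
      simp only [hB, Matrix.of_apply, hc'.1, this, if_false, mul_zero]
    · simp
    · simp
  have hdet : pairDet u h = C.det := by rw [hC, Matrix.det_mul, hdetB, mul_one]; rfl
  set D := (C.submatrix (fun i : Fin N => (j.succAbove i).succ)
    (fun c : Fin N => c.succ.succ)).det with hD
  have hminor : D = (∏ i : Fin N, (u (j.succAbove i).succ - a)) *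
      pairDet (fun i : Fin N => u (j.succAbove i).succ) (fun i => h (j.succAbove i).succ) := by
    rw [hD, pairDet, ← Matrix.det_mul_column]
    congr 1
    ext i c
    simp only [Matrix.submatrix_apply, Matrix.of_apply, hC2]
  have hz0 : ∀ c : Fin N, C 0 c.succ.succ = 0 := fun c => by rw [hC2, hj]; simp
  have hzj : ∀ c : Fin N, C j.succ c.succ.succ = 0 := fun c => by rw [hC2, ← ha]; simp
  have e0 : (C.submatrix Fin.succ (Fin.succAbove 0)).det = (-1) ^ (j : ℕ) * h j.succ 1 * D := by
    rw [Matrix.det_succ_row _ j, Fin.sum_univ_succ, Finset.sum_eq_zero]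
    · simp only [Matrix.submatrix_apply, Fin.succAbove_zero, hC1, Matrix.submatrix_submatrix,
        Fin.val_zero, add_zero, hD]
      rfl
    · intro c _
      simp only [Matrix.submatrix_apply, Fin.succAbove_zero, hzj, mul_zero, zero_mul]
  have e1 : (C.submatrix Fin.succ (Fin.succAbove (Fin.succ 0))).det =
      (-1) ^ (j : ℕ) * h j.succ 0 * D := by
    rw [Matrix.det_succ_row _ j, Fin.sum_univ_succ, Finset.sum_eq_zero]
    · simp only [Matrix.submatrix_apply, Fin.succ_succAbove_zero, hC0, Matrix.submatrix_submatrix,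
        Fin.val_zero, add_zero, hD]
      congr 3
    · intro c _
      simp only [Matrix.submatrix_apply, Fin.succ_succAbove_succ, Fin.succAbove_zero, hzj,
        mul_zero, zero_mul]
  rw [hdet, Matrix.det_succ_row_zero, Fin.sum_univ_succ, Fin.sum_univ_succ, Finset.sum_eq_zero]
  · rw [e0, e1, hC0, hC1, mul_assoc _ (∏ i : Fin N, _), ← hminor]
    simp
    ring
  · intro c _
    rw [hz0]; ring

open Polynomial in
/-- As a function of a single node, the determinant is a polynomial of degree less than half
the size. -/
theorem exists_pairDet_update_eq_eval {R : Type*} [CommRing R] {N : ℕ} (u : Fin N → R)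
    (h : Fin N → ℕ → R) (r : Fin N) :
    ∃ P : R[X], P.natDegree ≤ (N - 1) / 2 ∧
      ∀ t, pairDet (Function.update u r t) h = P.eval t := by
  obtain ⟨N, rfl⟩ : ∃ M, N = M + 1 := ⟨N - 1, by have := r.2; omega⟩
  refine ⟨∑ c : Fin (N + 1), C ((-1) ^ ((r : ℕ) + (c : ℕ)) * h r ((c : ℕ) % 2) *
    (Matrix.of fun (i : Fin N) (c' : Fin N) =>
      u (r.succAbove i) ^ ((c.succAbove c' : ℕ) / 2) *
        h (r.succAbove i) ((c.succAbove c' : ℕ) % 2)).det) *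
      X ^ ((c : ℕ) / 2), ?_, fun t => ?_⟩
  · refine natDegree_sum_le_of_forall_le _ _ fun c _ => ?_
    refine (natDegree_C_mul_X_pow_le _ _).trans ?_
    have := c.2
    omega
  · rw [pairDet, Matrix.det_succ_row _ r, eval_finsetSum]
    refine Finset.sum_congr rfl fun c _ => ?_
    simp only [Matrix.of_apply, Function.update_self, eval_mul, eval_C, eval_pow, eval_X]
    have : (Matrix.of fun (i c : Fin (N + 1)) => Function.update u r t i ^ ((c : ℕ) / 2) *
        h i ((c : ℕ) % 2)).submatrix r.succAbove c.succAbove =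
        Matrix.of fun (i : Fin N) (c' : Fin N) => u (r.succAbove i) ^ ((c.succAbove c' : ℕ) / 2) *
          h (r.succAbove i) ((c.succAbove c' : ℕ) % 2) := by
      ext
      simp
    rw [this]
    ring

open Polynomial in
/-- Lagrange interpolation at `v_0, …, v_N`. -/
theorem eval_eq_sum_nodes {N : ℕ} (v : Fin (N + 1) → K) (hv : Function.Injective v)
    (P : K[X]) (hP : P.natDegree ≤ N) (t : K) :
    P.eval t = ∑ j, P.eval (v j) *
      ∏ i : Fin N, ((t - v (j.succAbove i)) / (v j - v (j.succAbove i))) := by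
  have hdeg : P.degree < ((Finset.univ : Finset (Fin (N + 1))).card : WithBot ℕ) := by
    refine lt_of_le_of_lt degree_le_natDegree ?_
    rw [Finset.card_univ, Fintype.card_fin]
    exact_mod_cast Nat.lt_succ_of_le hP
  conv_lhs => rw [Lagrange.eq_interpolate (s := Finset.univ) (v := v) hv.injOn hdeg]
  rw [Lagrange.interpolate_apply, eval_finsetSum]
  refine Finset.sum_congr rfl fun j _ => ?_
  rw [eval_mul, eval_C, Lagrange.basis, eval_prod]
  congr 1
  have : (Finset.univ.erase j) = Finset.univ.map j.succAboveEmb := by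
    ext i
    simp [Fin.exists_succAbove_eq_iff]
  rw [this, Finset.prod_map]
  refine Finset.prod_congr rfl fun i _ => ?_
  simp [Lagrange.basisDivisor]
  ring

end PairDet

/-! ### The Cauchy-type determinant and the Schur-type Pfaffian of two-column Vandermondes -/

section Cores

variable {K : Type*} [Field K]

/-- `pairDet_of_eq` with the row selection described by the values of the indices, so that it
applies to sizes that are not literally of the form `M + 2`. -/
theorem pairDet_of_eq_of_val {R : Type*} [CommRing R] {N M : ℕ} (hN : N = M + 2) (u : Fin N → R)
    (h : Fin N → ℕ → R) (j : ℕ) (r s : Fin N) (hr : (r : ℕ) = 0) (hs : (s : ℕ) = j + 1)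
    (e : Fin M → Fin N) (he : ∀ i, (e i : ℕ) = if (i : ℕ) < j then (i : ℕ) + 1 else i + 2)
    (huv : u r = u s) :
    pairDet u h = (-1) ^ j * (h r 0 * h s 1 - h s 0 * h r 1) *
      (∏ i, (u (e i) - u s)) * pairDet (fun i => u (e i)) (fun i => h (e i)) := by
  subst hN
  have hj : j < M + 1 := by have := s.2; omega
  obtain rfl : r = 0 := Fin.ext hr
  obtain rfl : s = Fin.succ ⟨j, hj⟩ := Fin.ext hs
  obtain rfl : e = fun i => ((⟨j, hj⟩ : Fin (M + 1)).succAbove i).succ := by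
    funext i
    ext
    rw [he, Fin.val_succ, Fin.succAbove]
    simp only [Fin.lt_def, Fin.val_castSucc]
    split_ifs <;> simp
  exact pairDet_of_eq u h ⟨j, hj⟩ huv

/-- A generalization of Cauchy's determinant. -/
theorem det_cauchy_pairDet {n : ℕ} (u v : Fin n → K) (h g : Fin n → ℕ → K)
    (hv : Function.Injective v) (huv : ∀ i j, v j - u i ≠ 0) :
    (Matrix.of fun i j => (h i 0 * g j 1 - g j 0 * h i 1) / (v j - u i)).det *
      ∏ i, ∏ j, (v j - u i) = pairDet (Fin.append u v) (Fin.append h g) := by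
  induction n with
  | zero => simp [pairDet]
  | succ n ih =>
    set r : Fin (n + 1 + (n + 1)) := Fin.castAdd (n + 1) 0 with hr
    obtain ⟨P, hdeg, hP⟩ := exists_pairDet_update_eq_eval (Fin.append u v) (Fin.append h g) r
    have hu0 : pairDet (Fin.append u v) (Fin.append h g) = P.eval (u 0) := by
      rw [← hP, ← Fin.append_left u v 0, Function.update_eq_self]
    rw [hu0, eval_eq_sum_nodes v hv P (by omega), Matrix.det_succ_row_zero, Finset.sum_mul]
    refine Finset.sum_congr rfl fun j _ => ?_
    set e : Fin (n + n) → Fin (n + 1 + (n + 1)) :=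
      Fin.append (fun a => Fin.castAdd (n + 1) a.succ)
        (fun b => Fin.natAdd (n + 1) (j.succAbove b)) with he
    have hev : ∀ i, (e i : ℕ) = if (i : ℕ) < n + j then (i : ℕ) + 1 else i + 2 := by
      intro i
      refine Fin.addCases (fun a => ?_) (fun b => ?_) i
      · simp [he]
        omega
      · simp only [he, Fin.append_right, Fin.val_natAdd, Fin.succAbove, Fin.lt_def,
          Fin.val_castSucc]
        split_ifs <;> simp at * <;> omega
    have hne : ∀ i, e i ≠ r := by
      intro i hi
      have h1 := hev i
      have h2 : (e i : ℕ) = 0 := by rw [hi]; rfl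
      split_ifs at h1 <;> omega
    have hs : ∀ t : K, Function.update (Fin.append u v) r t (Fin.natAdd (n + 1) j) = v j := by
      intro t
      rw [Function.update_of_ne, Fin.append_right]
      intro hh
      have := congrArg Fin.val hh
      simp [hr] at this
    have hPv : P.eval (v j) = (-1) ^ (n + (j : ℕ)) * (h 0 0 * g j 1 - g j 0 * h 0 1) *
        ((∏ a : Fin n, (u a.succ - v j)) * ∏ b : Fin n, (v (j.succAbove b) - v j)) *
        pairDet (Fin.append (fun a => u (Fin.succ a)) (fun b => v (j.succAbove b)))
          (Fin.append (fun a => h (Fin.succ a)) (fun b => g (j.succAbove b))) := by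
      rw [← hP, pairDet_of_eq_of_val (M := n + n) (by omega) _ _ (n + j) r
        (Fin.natAdd (n + 1) j) rfl (by rw [Fin.val_natAdd]; ring) e hev
        (by rw [hs, Function.update_self])]
      simp only [hs, Function.update_of_ne (hne _)]
      have h1 : ∀ i, Fin.append u v (e i) =
          Fin.append (fun a => u (Fin.succ a)) (fun b => v (j.succAbove b)) i := fun i => by
        refine Fin.addCases (fun a => ?_) (fun b => ?_) i <;>
          simp only [he, Fin.append_left, Fin.append_right]
      have h2 : ∀ i, Fin.append h g (e i) =
          Fin.append (fun a => h (Fin.succ a)) (fun b => g (j.succAbove b)) i := fun i => by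
        refine Fin.addCases (fun a => ?_) (fun b => ?_) i <;>
          simp only [he, Fin.append_left, Fin.append_right]
      simp only [h1, h2, Fin.prod_univ_add, Fin.append_left, Fin.append_right, hr]
    rw [hPv, ← ih (fun a => u (Fin.succ a)) (fun b => v (j.succAbove b))
      (fun a => h (Fin.succ a)) (fun b => g (j.succAbove b)) (hv.comp Fin.succAbove_right_injective) (fun i k => huv _ _)]
    have hneg : ∏ a : Fin n, (u a.succ - v j) = (-1) ^ n * ∏ a : Fin n, (v j - u a.succ) := by
      have : ∏ _a : Fin n, (-1 : K) = (-1) ^ n := by simp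
      rw [← this, ← Finset.prod_mul_distrib]
      exact Finset.prod_congr rfl fun a _ => by ring
    have hq : (∏ b : Fin n, (v (j.succAbove b) - v j)) *
        ∏ b : Fin n, ((u 0 - v (j.succAbove b)) / (v j - v (j.succAbove b))) =
        ∏ b : Fin n, (v (j.succAbove b) - u 0) := by
      rw [← Finset.prod_mul_distrib]
      refine Finset.prod_congr rfl fun b _ => ?_
      have : v j - v (j.succAbove b) ≠ 0 :=
        sub_ne_zero.2 fun hh => Fin.succAbove_ne j b (hv hh).symm
      field_simp
      ring
    have hsq : ((-1 : K) ^ n) * (-1) ^ n = 1 := by rw [← pow_add, Even.neg_one_pow ⟨_, rfl⟩]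
    have hprod : ∏ i, ∏ k, (v k - u i) = (v j - u 0) * (∏ b : Fin n, (v (j.succAbove b) - u 0)) *
        ((∏ a : Fin n, (v j - u a.succ)) *
          ∏ a : Fin n, ∏ b : Fin n, (v (j.succAbove b) - u a.succ)) := by
      rw [Fin.prod_univ_succ, Fin.prod_univ_succAbove _ j, ← Finset.prod_mul_distrib]
      congr 1
      exact Finset.prod_congr rfl fun a _ => by rw [Fin.prod_univ_succAbove _ j]
    have hM : (Matrix.of fun i j => (h i 0 * g j 1 - g j 0 * h i 1) / (v j - u i)).submatrix
        Fin.succ j.succAbove = Matrix.of fun a b => (h (Fin.succ a) 0 * g (j.succAbove b) 1 -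
          g (j.succAbove b) 0 * h (Fin.succ a) 1) / (v (j.succAbove b) - u (Fin.succ a)) := rfl
    rw [hprod, hM, Matrix.of_apply, hneg, ← hq, pow_add]
    have := huv 0 j
    set W := (Matrix.of fun a b => (h (Fin.succ a) 0 * g (j.succAbove b) 1 -
          g (j.succAbove b) 0 * h (Fin.succ a) 1) / (v (j.succAbove b) - u (Fin.succ a))).det
    field_simp
    linear_combination (-(∏ b : Fin n, (v (j.succAbove b) - v j)) *
        (∏ b : Fin n, ((u 0 - v (j.succAbove b)) / (v j - v (j.succAbove b)))) * W *
      (∏ a : Fin n, (v j - u a.succ)) *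
      (∏ a : Fin n, ∏ b : Fin n, (v (j.succAbove b) - u a.succ)) *
      (h 0 0 * g j 1 - g j 0 * h 0 1)) * hsq

/-- The Lagrange interpolation formula, in the first node, for a product of two determinants of
even size `2n + 2`: the product has degree at most `2n`, and there are `2n + 1` other nodes. -/
theorem pairDet_mul_pairDet {n : ℕ} (u : Fin (2 * n + 2) → K) (h g : Fin (2 * n + 2) → ℕ → K)
    (hu : Function.Injective fun i => u (Fin.succ i)) :
    pairDet u h * pairDet u g = ∑ j : Fin (2 * n + 1),
      (h 0 0 * h j.succ 1 - h j.succ 0 * h 0 1) * (g 0 0 * g j.succ 1 - g j.succ 0 * g 0 1) *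
      (∏ i, ((u (j.succAbove i).succ - u j.succ) * (u (j.succAbove i).succ - u 0))) *
      (pairDet (fun i => u (j.succAbove i).succ) (fun i => h (j.succAbove i).succ) *
        pairDet (fun i => u (j.succAbove i).succ) (fun i => g (j.succAbove i).succ)) := by
  obtain ⟨P, hdegP, hP⟩ := exists_pairDet_update_eq_eval u h 0
  obtain ⟨Q, hdegQ, hQ⟩ := exists_pairDet_update_eq_eval u g 0
  have hPQ : (P * Q).natDegree ≤ 2 * n := Polynomial.natDegree_mul_le.trans (by omega)
  have hL : pairDet u h * pairDet u g = (P * Q).eval (u 0) := by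
    rw [Polynomial.eval_mul, ← hP, ← hQ, Function.update_eq_self]
  rw [hL, eval_eq_sum_nodes _ hu _ hPQ]
  refine Finset.sum_congr rfl fun j _ => ?_
  have hup : ∀ t i, Function.update u 0 t (Fin.succ i) = u i.succ :=
    fun t i => Function.update_of_ne (Fin.succ_ne_zero _) _ _
  rw [Polynomial.eval_mul, ← hP, ← hQ, pairDet_of_eq _ _ j (by rw [hup, Function.update_self]),
    pairDet_of_eq _ _ j (by rw [hup, Function.update_self])]
  simp only [hup]
  have hq : (∏ i, ((u (j.succAbove i).succ - u j.succ) * (u (j.succAbove i).succ - u 0))) =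
      (∏ i, (u (j.succAbove i).succ - u j.succ)) * (∏ i, (u (j.succAbove i).succ - u j.succ)) *
      ∏ i, ((u 0 - u (j.succAbove i).succ) / (u j.succ - u (j.succAbove i).succ)) := by
    rw [← Finset.prod_mul_distrib, ← Finset.prod_mul_distrib]
    refine Finset.prod_congr rfl fun b _ => ?_
    have : u j.succ - u (j.succAbove b).succ ≠ 0 :=
      sub_ne_zero.2 fun hh => Fin.succAbove_ne j b (hu hh).symm
    field_simp
    ring
  have hsq : ((-1 : K) ^ (j : ℕ)) * (-1) ^ (j : ℕ) = 1 := by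
    rw [← pow_add, Even.neg_one_pow ⟨_, rfl⟩]
  rw [hq]
  set A := ∏ i, (u (j.succAbove i).succ - u j.succ)
  set B := ∏ i, ((u 0 - u (j.succAbove i).succ) / (u j.succ - u (j.succAbove i).succ))
  set D := pairDet (fun i => u (j.succAbove i).succ) (fun i => h (j.succAbove i).succ)
  set E := pairDet (fun i => u (j.succAbove i).succ) (fun i => g (j.succAbove i).succ)
  linear_combination ((h 0 0 * h j.succ 1 - h j.succ 0 * h 0 1) *
    (g 0 0 * g j.succ 1 - g j.succ 0 * g 0 1) * A * A * B * D * E) * hsq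

/-- A generalization of Schur's Pfaffian. -/
theorem pfaffian_pairDet {n : ℕ} (u : Fin (2 * n) → K) (h g : Fin (2 * n) → ℕ → K)
    (hu : Function.Injective u) :
    pfaffian (Matrix.of fun i j => (h i 0 * h j 1 - h j 0 * h i 1) *
      (g i 0 * g j 1 - g j 0 * g i 1) / (u j - u i)) * (Matrix.vandermonde u).det =
      pairDet u h * pairDet u g := by
  induction n with
  | zero => rw [pfaffian_zero]; simp [pairDet]
  | succ n ih =>
    have hu' : Function.Injective fun i => u (Fin.succ i) := hu.comp (Fin.succ_injective _)
    refine Eq.trans ?_ (pairDet_mul_pairDet (n := n) u h g hu').symm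
    rw [pfaffian_succ, Finset.sum_mul]
    refine Finset.sum_congr rfl fun j _ => ?_
    rw [← ih (fun i => u (j.succAbove i).succ) _ _ (hu'.comp Fin.succAbove_right_injective)]
    have hvand : (Matrix.vandermonde u).det = (u j.succ - u 0) *
        (∏ i, (u (j.succAbove i).succ - u 0)) * ((-1) ^ (j : ℕ) *
          (∏ i, (u (j.succAbove i).succ - u j.succ)) *
          (Matrix.vandermonde fun i => u (j.succAbove i).succ).det) := by
      refine (det_vandermonde_succ (N := 2 * n + 1) u).trans ?_
      rw [Fin.prod_univ_succAbove _ j, det_vandermonde_succAbove _ j]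
    rw [hvand, Finset.prod_mul_distrib, Matrix.of_apply]
    have hM : (Matrix.of fun i j => (h i 0 * h j 1 - h j 0 * h i 1) *
        (g i 0 * g j 1 - g j 0 * g i 1) / (u j - u i)).submatrix
        (fun i => (j.succAbove i).succ) (fun i => (j.succAbove i).succ) =
        Matrix.of fun i k => (h (j.succAbove i).succ 0 * h (j.succAbove k).succ 1 -
          h (j.succAbove k).succ 0 * h (j.succAbove i).succ 1) *
          (g (j.succAbove i).succ 0 * g (j.succAbove k).succ 1 -
          g (j.succAbove k).succ 0 * g (j.succAbove i).succ 1) /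
          (u (j.succAbove k).succ - u (j.succAbove i).succ) := rfl
    rw [hM]
    have hsq : ((-1 : K) ^ (j : ℕ)) * (-1) ^ (j : ℕ) = 1 := by
      rw [← pow_add, Even.neg_one_pow ⟨_, rfl⟩]
    have hne : u j.succ - u 0 ≠ 0 :=
      sub_ne_zero.2 fun hh => Fin.succ_ne_zero j (hu hh)
    generalize pfaffian (R := K) (n := n) _ = W
    generalize (Matrix.vandermonde fun i : Fin (2 * n) => u (j.succAbove i).succ).det = V
    generalize (∏ i : Fin (2 * n), (u (j.succAbove i).succ - u 0)) = A
    generalize (∏ i : Fin (2 * n), (u (j.succAbove i).succ - u j.succ)) = B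
    field_simp
    linear_combination ((h 0 0 * h j.succ 1 - h j.succ 0 * h 0 1) *
      (g 0 0 * g j.succ 1 - g j.succ 0 * g 0 1) * A * B * V * W) * hsq

end Cores

/-! ### Staircase Schur polynomials as quotients of determinants -/

section Staircase

open Matrix

variable {R S : Type*} [CommRing R] [CommRing S]

theorem map_alternant {N : ℕ} (f : R →+* S) (a : Fin N → ℕ) (x : Fin N → R) :
    f (alternant a x) = alternant a fun i => f (x i) := by
  rw [alternant, alternant, RingHom.map_det]
  congr 1
  ext
  simp

theorem alternant_staircase {k N : ℕ} (hk : k ≤ N) (v : Fin N → R) :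
    alternant (fun j : Fin N => (staircase k).rowLen j + rhoExp N j) v =
      alternant (rhoExp N) v * schur (staircase k) v := by
  have h := congrArg (MvPolynomial.aeval v).toRingHom (bialternant_spec (staircase k) N)
  rw [map_mul, map_alternant, map_alternant] at h
  have h0 : (staircase k).colLen 0 ≤ N := by rw [staircase_colLen]; omega
  simpa [schur, schurPoly, h0] using h

theorem map_schur {N : ℕ} (lam : YoungDiagram) (f : R →+* S) (v : Fin N → R) :
    f (schur lam v) = schur lam fun i => f (v i) := by
  rw [schur, schur, MvPolynomial.aeval_def, MvPolynomial.aeval_def, MvPolynomial.hom_eval₂]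
  congr 1
  exact RingHom.ext_int _ _

/-- The exponents of the numerator of `s_{δ(k)}` in `N ≥ k` variables, in increasing order. They
are `0, 1, …, N - k - 1` followed by `N - k + 1, N - k + 3, …, N + k - 1`. -/
def stairExp (k N j : ℕ) : ℕ := j + (k + 1 + j - N)

theorem alternant_eq_sign_mul {N : ℕ} (a : Fin N → ℕ) (v : Fin N → R) :
    alternant a v = ((Equiv.Perm.sign (Fin.revPerm : Equiv.Perm (Fin N)) : ℤ) : R) *
      (Matrix.of fun i j : Fin N => v i ^ a j.rev).det := by
  have h := Matrix.det_permute' Fin.revPerm (Matrix.of fun i j : Fin N => v i ^ a j.rev)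
  rw [← h, alternant]
  congr 1
  ext
  simp

/-- The bialternant formula for `δ(k)`, with the columns in increasing order of exponents. -/
theorem schur_staircase_mul_vandermonde {k N : ℕ} (hk : k ≤ N) (v : Fin N → R) :
    schur (staircase k) v * (vandermonde v).det =
      (Matrix.of fun i j : Fin N => v i ^ stairExp k N j).det := by
  have h := alternant_staircase hk v
  rw [alternant_eq_sign_mul, alternant_eq_sign_mul (rhoExp N), mul_assoc] at h
  have hsign : IsUnit ((Equiv.Perm.sign (Fin.revPerm : Equiv.Perm (Fin N)) : ℤ) : R) := by
    have : IsUnit ((Equiv.Perm.sign (Fin.revPerm : Equiv.Perm (Fin N)) : ℤ)) := Units.isUnit _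
    exact this.map (Int.castRingHom R)
  have h2 := hsign.mul_left_cancel h
  have e1 : (Matrix.of fun i j : Fin N => v i ^ rhoExp N j.rev) = vandermonde v := by
    ext i j
    have : N - 1 - (N - ((j : ℕ) + 1)) = j := by omega
    simp [rhoExp, vandermonde_apply, Fin.val_rev, this]
  have e2 : (Matrix.of fun i j : Fin N => v i ^ ((staircase k).rowLen j.rev + rhoExp N j.rev)) =
      Matrix.of fun i j : Fin N => v i ^ stairExp k N j := by
    ext i j
    have : k - (N - ((j : ℕ) + 1)) + (N - 1 - (N - ((j : ℕ) + 1))) = j + (k + 1 + j - N) := by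
      omega
    simp [rhoExp, stairExp, staircase_rowLen, Fin.val_rev, this]
  rw [e1, e2] at h2
  rw [h2, mul_comm]

theorem stairExp_strictMono (k N : ℕ) : StrictMono (stairExp k N) := fun a b h => by
  unfold stairExp; omega

theorem map_schurPoly_staircase_ne_zero (K : Type*) [Field K] {k m : ℕ} (hk : k ≤ m) :
    MvPolynomial.map (Int.castRingHom K) (schurPoly (staircase k) m) ≠ 0 := by
  intro h
  -- At the point `X_i = T ^ i` the numerator is a Vandermonde determinant in powers of `T`.
  set v : Fin m → Polynomial K := fun i => Polynomial.X ^ (i : ℕ) with hv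
  have hs : schur (staircase k) v = 0 := by
    have := congrArg (MvPolynomial.aeval v) h
    rw [map_zero, MvPolynomial.aeval_def, MvPolynomial.eval₂_map] at this
    rw [schur, MvPolynomial.aeval_def, ← this]
    congr 1
  have hdet := schur_staircase_mul_vandermonde hk v
  rw [hs, zero_mul] at hdet
  have e : (Matrix.of fun i j : Fin m => v i ^ stairExp k m j) =
      (vandermonde fun j : Fin m => (Polynomial.X ^ stairExp k m j : Polynomial K))ᵀ := by
    ext i j : 2
    simp only [hv, Matrix.of_apply, transpose_apply, vandermonde_apply, ← pow_mul]
    rw [mul_comm]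
  rw [e, det_transpose] at hdet
  refine det_vandermonde_ne_zero_iff.2 ?_ hdet.symm
  intro a b hab
  have := congrArg Polynomial.natDegree hab
  simp only [Polynomial.natDegree_X_pow] at this
  exact Fin.ext ((stairExp_strictMono k m).injective this)

end Staircase

/-! ### Reduction to two-column Vandermonde determinants -/

section Reduction

variable {K : Type*} [Field K]

theorem stairExp_add_castAdd {k m : ℕ} (hk : k ≤ m) {p : ℕ} (c : Fin p) :
    stairExp k (p + m) (Fin.castAdd m c : Fin (p + m)) = c := by
  simp only [stairExp, Fin.val_castAdd]
  omega

theorem stairExp_add_natAdd {k m : ℕ} {p : ℕ} (j : Fin m) :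
    stairExp k (p + m) (Fin.natAdd p j : Fin (p + m)) = p + stairExp k m j := by
  simp only [stairExp, Fin.val_natAdd]
  omega

/-- Shifting an exponent by two stays in the exponent set, which for `p` additional variables is
`{0, …, p - 1}` together with the shift by `p` of the exponents for `m` variables. -/
theorem exists_stairExp_eq {k m p c : ℕ} (hk : k ≤ m) (hp : Even p) (hc : c < p) (j : Fin m)
    (h : p ≤ stairExp k m j + 2 + 2 * (c / 2)) :
    ∃ j' : Fin m, stairExp k m j + 2 + 2 * (c / 2) = p + stairExp k m j' := by
  obtain ⟨q, rfl⟩ := hp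
  have hj := j.2
  obtain ⟨g, hg⟩ := Nat.exists_eq_add_of_le h
  obtain ⟨s, rfl⟩ : ∃ s, q = c / 2 + 1 + s := ⟨q - (c / 2 + 1), by omega⟩
  unfold stairExp at *
  by_cases hgk : g + k + 1 ≤ m
  · exact ⟨⟨g, by omega⟩, by simp only; omega⟩
  · exact ⟨⟨j - s, by omega⟩, by simp only; omega⟩

open Matrix in
/-- For `h_q(t) = t^q - ∑_j a_{q j} t^{e_j + 2}` vanishing at all `z_c`, where `e_j` are the
staircase exponents, the functions `t^{2 i} h_q` arise from the powers of `t` by a unitriangular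
change of columns. As they vanish at the `z_c`, the numerator of the Schur polynomial factors. -/
theorem det_stairExp_append {k m p : ℕ} (hk : k ≤ m) (hp : Even p) (x : Fin p → K)
    (z : Fin m → K) (a : ℕ → Fin m → K)
    (ha : ∀ q c, ∑ j : Fin m, a q j * z c ^ (stairExp k m j + 2) = z c ^ q) :
    (Matrix.of fun i j : Fin (p + m) => Fin.append x z i ^ stairExp k (p + m) j).det =
      pairDet (fun i => x i ^ 2)
        (fun i q => x i ^ q - ∑ j : Fin m, a q j * x i ^ (stairExp k m j + 2)) *
        ((∏ c, z c ^ p) * (Matrix.of fun c j : Fin m => z c ^ stairExp k m j).det) := by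
  set W : Matrix (Fin p ⊕ Fin m) (Fin p ⊕ Fin m) K := Matrix.of fun i c =>
    Sum.elim x z i ^ Sum.elim (fun c : Fin p => (c : ℕ)) (fun j : Fin m => p + stairExp k m j) c
    with hW
  have h1 : (Matrix.of fun i j : Fin (p + m) => Fin.append x z i ^ stairExp k (p + m) j).det =
      W.det := by
    rw [← det_submatrix_equiv_self finSumFinEquiv]
    congr 1
    ext i c
    rcases i with i | i <;> rcases c with c | c <;>
      simp only [hW, submatrix_apply, Matrix.of_apply, finSumFinEquiv_apply_left,
        finSumFinEquiv_apply_right, Fin.append_left, Fin.append_right, stairExp_add_castAdd hk,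
        stairExp_add_natAdd, Sum.elim_inl, Sum.elim_inr]
  -- `f j c` is the exponent of the `j`-th correction term of the `c`-th new column.
  set f : Fin m → Fin p → ℕ := fun j c => stairExp k m j + 2 + 2 * ((c : ℕ) / 2) with hf
  have hfc : ∀ j (c : Fin p), (c : ℕ) < f j c := fun j c => by simp only [hf]; omega
  set T : Matrix (Fin p) (Fin p) K := Matrix.of fun c' c =>
    (if c' = c then 1 else 0) - ∑ j, if f j c = c' then a ((c : ℕ) % 2) j else 0 with hT
  set Y : Matrix (Fin m) (Fin p) K := Matrix.of fun j' c =>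
    - ∑ j, if f j c = p + stairExp k m j' then a ((c : ℕ) % 2) j else 0 with hY
  have hT1 : T.det = 1 := by
    rw [det_of_isLowerTriangular]
    · refine Finset.prod_eq_one fun c _ => ?_
      have : ∀ j, f j c ≠ c := fun j => (hfc j c).ne'
      simp [hT, this]
    · intro c' c hlt
      have hlt' : c' < c := hlt
      have h2 : ∀ j, f j c ≠ c' := fun j h => by
        have := hfc j c
        rw [Fin.lt_def] at hlt'
        omega
      simp [hT, hlt'.ne, h2]
  -- Each exponent `f j c` occurs exactly once among the columns of `W`.
  have hsum : ∀ (t : K) (j : Fin m) (c : Fin p),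
      (∑ c' : Fin p, if f j c = c' then t ^ (c' : ℕ) else 0) +
        (∑ j' : Fin m, if f j c = p + stairExp k m j' then t ^ (p + stairExp k m j') else 0) =
        t ^ f j c := by
    intro t j c
    by_cases hlt : f j c < p
    · rw [Finset.sum_eq_single ⟨f j c, hlt⟩, Finset.sum_eq_zero]
      · simp
      · intro j' _
        rw [if_neg (by omega)]
      · intro c' _ hc'
        rw [if_neg]
        intro h
        exact hc' (Fin.ext h.symm)
      · simp
    · obtain ⟨j₀, hj₀⟩ := exists_stairExp_eq hk hp c.2 j (not_lt.1 hlt)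
      rw [Finset.sum_eq_zero, Finset.sum_eq_single j₀]
      · rw [if_pos hj₀, ← hj₀, zero_add]
      · intro j' _ hj'
        rw [if_neg]
        intro h
        refine hj' (Fin.ext ((stairExp_strictMono k m).injective ?_))
        have : p + stairExp k m j₀ = p + stairExp k m j' := hj₀.symm.trans h
        omega
      · simp
      · intro c' _
        have := c'.2
        rw [if_neg (by omega)]
  have hcol : ∀ (t : K) (c : Fin p),
      (∑ c' : Fin p, t ^ (c' : ℕ) * T c' c) + (∑ j' : Fin m, t ^ (p + stairExp k m j') * Y j' c) =
      (t ^ 2) ^ ((c : ℕ) / 2) *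
        (t ^ ((c : ℕ) % 2) - ∑ j : Fin m, a ((c : ℕ) % 2) j * t ^ (stairExp k m j + 2)) := by
    intro t c
    have hc : t ^ (c : ℕ) = (t ^ 2) ^ ((c : ℕ) / 2) * t ^ ((c : ℕ) % 2) := by
      rw [← pow_mul, ← pow_add, Nat.div_add_mod]
    have e1 : ∑ c' : Fin p, t ^ (c' : ℕ) * T c' c = t ^ (c : ℕ) -
        ∑ j, a ((c : ℕ) % 2) j * ∑ c' : Fin p, if f j c = c' then t ^ (c' : ℕ) else 0 := by
      simp only [hT, Matrix.of_apply, mul_sub, Finset.sum_sub_distrib, mul_ite, mul_one, mul_zero,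
        Finset.sum_ite_eq', Finset.mem_univ, if_true, Finset.mul_sum]
      rw [Finset.sum_comm]
      simp only [mul_comm]
    have e2 : ∑ j' : Fin m, t ^ (p + stairExp k m j') * Y j' c =
        - ∑ j, a ((c : ℕ) % 2) j * ∑ j' : Fin m,
          if f j c = p + stairExp k m j' then t ^ (p + stairExp k m j') else 0 := by
      simp only [hY, Matrix.of_apply, mul_neg, Finset.sum_neg_distrib, mul_ite, mul_zero,
        Finset.mul_sum]
      rw [Finset.sum_comm]
      simp only [mul_comm]
    rw [e1, e2, ← sub_eq_add_neg, sub_sub, ← Finset.sum_add_distrib, mul_sub, ← hc,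
      Finset.mul_sum]
    congr 1
    refine Finset.sum_congr rfl fun j _ => ?_
    rw [← mul_add, hsum, hf]
    simp only
    rw [pow_add _ (stairExp k m j + 2), pow_mul]
    ring
  have hprod : W * fromBlocks T 0 Y 1 = fromBlocks
      (Matrix.of fun i c : Fin p => (x i ^ 2) ^ ((c : ℕ) / 2) *
        (x i ^ ((c : ℕ) % 2) - ∑ j : Fin m, a ((c : ℕ) % 2) j * x i ^ (stairExp k m j + 2)))
      (Matrix.of fun (i : Fin p) (j : Fin m) => x i ^ (p + stairExp k m j)) 0
      (Matrix.of fun (i j : Fin m) => z i ^ (p + stairExp k m j)) := by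
    ext i c
    rcases i with i | i <;> rcases c with c | c <;>
      simp only [mul_apply, Fintype.sum_sum_type, hW, Matrix.of_apply, Sum.elim_inl, Sum.elim_inr,
        fromBlocks_apply₁₁, fromBlocks_apply₁₂, fromBlocks_apply₂₁, fromBlocks_apply₂₂, hcol, ha,
        sub_self, mul_zero, Matrix.zero_apply, Finset.sum_const_zero, zero_add, one_apply, mul_ite,
        mul_one, Finset.sum_ite_eq', Finset.mem_univ, if_true]
  have hdet := congrArg det hprod
  rw [det_mul, det_fromBlocks_zero₁₂, det_fromBlocks_zero₂₁, hT1, det_one, mul_one, mul_one,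
    ← h1] at hdet
  rw [hdet, pairDet, ← det_mul_column]
  simp only [pow_add, Matrix.of_apply]

/-- After normalization, the values of a staircase Schur polynomial with `z` fixed are two-column
Vandermonde determinants in the squares of the remaining variables, divided by the Vandermonde
determinant. The same `h` serves for all numbers of remaining variables. -/
theorem exists_schur_append_eq_pairDet {k m : ℕ} (hk : k ≤ m) (z : Fin m → K)
    (hz : Function.Injective z) (hz0 : ∀ c, z c ≠ 0) (hs : schur (staircase k) z ≠ 0) :
    ∃ h : K → ℕ → K, ∀ (p : ℕ) (x : Fin p → K), Even p → (∀ i c, x i ≠ z c) →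
      schur (staircase k) (Fin.append x z) / schur (staircase k) z *
        (Matrix.vandermonde x).det = pairDet (fun i => x i ^ 2) (fun i => h (x i)) := by
  have hVz : (Matrix.vandermonde z).det ≠ 0 := Matrix.det_vandermonde_ne_zero_iff.2 hz
  have hEz : (Matrix.of fun c j : Fin m => z c ^ stairExp k m j).det ≠ 0 := by
    rw [← schur_staircase_mul_vandermonde hk]
    exact mul_ne_zero hs hVz
  set A : Matrix (Fin m) (Fin m) K := Matrix.of fun c j => z c ^ 2 * z c ^ stairExp k m j with hA
  have hAdet : IsUnit A.det := by
    rw [isUnit_iff_ne_zero]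
    have : A.det = (∏ c, z c ^ 2) * (Matrix.of fun c j : Fin m => z c ^ stairExp k m j).det := by
      rw [← Matrix.det_mul_column]
      rfl
    rw [this]
    exact mul_ne_zero (Finset.prod_ne_zero_iff.2 fun c _ => pow_ne_zero _ (hz0 c)) hEz
  set a : ℕ → Fin m → K := fun q => A⁻¹.mulVec fun c => z c ^ q with ha_def
  have ha : ∀ q c, ∑ j : Fin m, a q j * z c ^ (stairExp k m j + 2) = z c ^ q := by
    intro q c
    have h := congrFun (show A.mulVec (a q) = fun c => z c ^ q by
      rw [ha_def, Matrix.mulVec_mulVec, Matrix.mul_nonsing_inv _ hAdet, Matrix.one_mulVec]) c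
    rw [← h, Matrix.mulVec, dotProduct]
    exact Finset.sum_congr rfl fun j _ => by rw [hA, Matrix.of_apply]; ring
  refine ⟨fun t q => (∏ c, z c / (z c - t)) *
    (t ^ q - ∑ j : Fin m, a q j * t ^ (stairExp k m j + 2)), fun p x hp hx => ?_⟩
  rw [pairDet_mul]
  have h1 := schur_staircase_mul_vandermonde (k := k) (N := p + m) (by omega) (Fin.append x z)
  rw [det_stairExp_append hk hp x z a ha, ← schur_staircase_mul_vandermonde hk,
    det_vandermonde_append] at h1
  have hX : ∏ i, ∏ c, (z c - x i) ≠ 0 :=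
    Finset.prod_ne_zero_iff.2 fun i _ => Finset.prod_ne_zero_iff.2 fun c _ =>
      sub_ne_zero.2 (hx i c).symm
  have hγ : ∏ i, ∏ c, (z c / (z c - x i)) = (∏ c, z c ^ p) / ∏ i, ∏ c, (z c - x i) := by
    simp only [Finset.prod_div_distrib, Finset.prod_const, Finset.card_univ, Fintype.card_fin,
      Finset.prod_pow]
  rw [hγ]
  field_simp
  refine mul_right_cancel₀ hVz ?_
  linear_combination h1

end Reduction

/-! ### The two identities at a generic point -/

theorem map_append {A B : Type*} {p q : ℕ} (f : A → B) (x : Fin p → A) (z : Fin q → A) :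
    (fun i => f (Fin.append x z i)) = Fin.append (fun a => f (x a)) (fun c => f (z c)) := by
  funext i
  refine Fin.addCases (fun a => ?_) (fun a => ?_) i <;>
    simp only [Fin.append_left, Fin.append_right]

section Generic

variable {K : Type*} [Field K]

theorem det_schur_of_generic {n m k : ℕ} (hk : k ≤ m) (x y : Fin n → K) (z : Fin m → K)
    (hz : Function.Injective z) (hz0 : ∀ c, z c ≠ 0) (hs : schur (staircase k) z ≠ 0)
    (hxz : ∀ i c, x i ≠ z c) (hyz : ∀ i c, y i ≠ z c)
    (hy : Function.Injective fun j => y j ^ 2) (hxy : ∀ i j, y j ^ 2 - x i ^ 2 ≠ 0) :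
    (Matrix.of fun i j : Fin n => 1 / (x i + y j) *
        (schur (staircase k) (Fin.append ![x i, y j] z) / schur (staircase k) z)).det =
      (∏ i, ∏ j ∈ Finset.Ioi i, (x j - x i) * (y j - y i)) / (∏ i, ∏ j, (x i + y j)) *
        (schur (staircase k) (Fin.append (Fin.append x y) z) / schur (staircase k) z) := by
  obtain ⟨h, hh⟩ := exists_schur_append_eq_pairDet hk z hz hz0 hs
  have hfac : ∀ i j, y j ^ 2 - x i ^ 2 = (y j - x i) * (x i + y j) := fun i j => by ring
  have hsub : ∀ i j, y j - x i ≠ 0 := fun i j h0 => hxy i j (by rw [hfac, h0, zero_mul])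
  have hadd : ∀ i j, x i + y j ≠ 0 := fun i j h0 => hxy i j (by rw [hfac, h0, mul_zero])
  have hA : (Matrix.of fun i j : Fin n => 1 / (x i + y j) *
      (schur (staircase k) (Fin.append ![x i, y j] z) / schur (staircase k) z)) =
      Matrix.of fun i j => (h (x i) 0 * h (y j) 1 - h (y j) 0 * h (x i) 1) /
        (y j ^ 2 - x i ^ 2) := by
    ext i j
    have h2 := hh 2 ![x i, y j] even_two (fun a c => by
      fin_cases a
      · exact hxz i c
      · exact hyz j c)
    rw [pairDet_two, Matrix.det_vandermonde] at h2
    have h3 : ∏ a : Fin 2, ∏ b ∈ Finset.Ioi a, (![x i, y j] b - ![x i, y j] a) = y j - x i := by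
      rw [Fin.prod_univ_two]
      have : Finset.Ioi (0 : Fin 2) = {1} := rfl
      have h' : Finset.Ioi (1 : Fin 2) = ∅ := rfl
      simp [this, h']
    simp only [h3, Matrix.cons_val_zero, Matrix.cons_val_one] at h2
    rw [Matrix.of_apply, Matrix.of_apply, ← h2, hfac]
    have := hsub i j
    have := hadd i j
    field_simp
  have hcore := det_cauchy_pairDet (fun i => x i ^ 2) (fun j => y j ^ 2) (fun i => h (x i))
    (fun j => h (y j)) hy hxy
  have hbig := hh (n + n) (Fin.append x y) ⟨n, rfl⟩ (fun i c => by
    refine Fin.addCases (fun a => ?_) (fun a => ?_) i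
    · rw [Fin.append_left]; exact hxz a c
    · rw [Fin.append_right]; exact hyz a c)
  rw [map_append (· ^ 2), map_append h, ← hcore, det_vandermonde_append] at hbig
  simp only [hfac, Finset.prod_mul_distrib] at hbig
  rw [hA]
  simp only [Finset.prod_mul_distrib, ← Matrix.det_vandermonde, hfac]
  have hP : ∏ i, ∏ j, (x i + y j) ≠ 0 :=
    Finset.prod_ne_zero_iff.2 fun i _ => Finset.prod_ne_zero_iff.2 fun c _ => hadd i c
  have hQ : ∏ i, ∏ j, (y j - x i) ≠ 0 :=
    Finset.prod_ne_zero_iff.2 fun i _ => Finset.prod_ne_zero_iff.2 fun c _ => hsub i c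
  rw [div_mul_eq_mul_div, eq_div_iff hP]
  refine mul_right_cancel₀ hQ ?_
  linear_combination -hbig

theorem pfaffian_schur_of_generic {n m m' k l : ℕ} (hk : k ≤ m) (hl : l ≤ m')
    (x : Fin (2 * n) → K) (z : Fin m → K) (w : Fin m' → K)
    (hz : Function.Injective z) (hz0 : ∀ c, z c ≠ 0) (hs : schur (staircase k) z ≠ 0)
    (hw : Function.Injective w) (hw0 : ∀ c, w c ≠ 0) (hs' : schur (staircase l) w ≠ 0)
    (hxz : ∀ i c, x i ≠ z c) (hxw : ∀ i c, x i ≠ w c)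
    (hx : Function.Injective fun j => x j ^ 2) :
    pfaffian (Matrix.of fun i j : Fin (2 * n) => (x j - x i) / (x j + x i) *
        (schur (staircase k) (Fin.append ![x i, x j] z) / schur (staircase k) z) *
        (schur (staircase l) (Fin.append ![x i, x j] w) / schur (staircase l) w)) =
      (∏ i, ∏ j ∈ Finset.Ioi i, (x j - x i) / (x j + x i)) *
        (schur (staircase k) (Fin.append x z) / schur (staircase k) z) *
        (schur (staircase l) (Fin.append x w) / schur (staircase l) w) := by
  obtain ⟨h, hh⟩ := exists_schur_append_eq_pairDet hk z hz hz0 hs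
  obtain ⟨g, hg⟩ := exists_schur_append_eq_pairDet hl w hw hw0 hs'
  have hfac : ∀ i j, x j ^ 2 - x i ^ 2 = (x j - x i) * (x j + x i) := fun i j => by ring
  have hsq : ∀ i j, i < j → x j ^ 2 - x i ^ 2 ≠ 0 := fun i j hij =>
    sub_ne_zero.2 fun h0 => hij.ne' (hx h0)
  have hsub : ∀ i j, i < j → x j - x i ≠ 0 := fun i j hij h0 =>
    hsq i j hij (by rw [hfac, h0, zero_mul])
  have hadd : ∀ i j, i < j → x j + x i ≠ 0 := fun i j hij h0 =>
    hsq i j hij (by rw [hfac, h0, mul_zero])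
  have h3 : ∀ i j, (Matrix.vandermonde ![x i, x j]).det = x j - x i := fun i j => by
    simp [Matrix.det_fin_two, Matrix.vandermonde_apply]
  rw [pfaffian_congr (B := Matrix.of fun i j =>
    (h (x i) 0 * h (x j) 1 - h (x j) 0 * h (x i) 1) *
      (g (x i) 0 * g (x j) 1 - g (x j) 0 * g (x i) 1) / (x j ^ 2 - x i ^ 2))]
  · have hcore := pfaffian_pairDet (fun i => x i ^ 2) (fun i => h (x i)) (fun i => g (x i)) hx
    rw [← hh _ x (even_two_mul n) hxz, ← hg _ x (even_two_mul n) hxw] at hcore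
    simp only [Matrix.det_vandermonde, hfac, Finset.prod_mul_distrib] at hcore
    simp only [hfac, Finset.prod_div_distrib]
    have hP : ∏ i, ∏ j ∈ Finset.Ioi i, (x j + x i) ≠ 0 :=
      Finset.prod_ne_zero_iff.2 fun i _ => Finset.prod_ne_zero_iff.2 fun c hc =>
        hadd i c (Finset.mem_Ioi.1 hc)
    have hQ : ∏ i, ∏ j ∈ Finset.Ioi i, (x j - x i) ≠ 0 :=
      Finset.prod_ne_zero_iff.2 fun i _ => Finset.prod_ne_zero_iff.2 fun c hc =>
        hsub i c (Finset.mem_Ioi.1 hc)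
    rw [div_mul_eq_mul_div, div_mul_eq_mul_div, eq_div_iff hP]
    refine mul_right_cancel₀ hQ ?_
    linear_combination hcore
  · intro i j hij
    have e1 := hh 2 ![x i, x j] even_two (fun a c => by
      fin_cases a
      · exact hxz i c
      · exact hxz j c)
    have e2 := hg 2 ![x i, x j] even_two (fun a c => by
      fin_cases a
      · exact hxw i c
      · exact hxw j c)
    rw [pairDet_two, h3] at e1 e2
    simp only [Matrix.cons_val_zero, Matrix.cons_val_one] at e1 e2
    rw [Matrix.of_apply, Matrix.of_apply, ← e1, ← e2, hfac]
    have := hsub i j hij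
    have := hadd i j hij
    field_simp

end Generic

/-! ### Identities with cleared denominators -/

section Cleared

variable {R S : Type*} [CommRing R] [CommRing S]

theorem map_schur_append_pair {q : ℕ} (lam : YoungDiagram) (f : R →+* S) (a b : R)
    (z : Fin q → R) :
    f (schur lam (Fin.append ![a, b] z)) =
      schur lam (Fin.append ![f a, f b] fun c => f (z c)) := by
  rw [map_schur, map_append f]
  congr 2
  funext j
  fin_cases j <;> rfl

/-- The difference of the two sides of the determinant identity after multiplication by all
denominators; a polynomial in the entries of `x`, `y` and `z`. -/
noncomputable def detDefect {n m : ℕ} (k : ℕ) (x y : Fin n → R) (z : Fin m → R) : R :=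
  (Matrix.of fun i j : Fin n => (∏ j' ∈ Finset.univ.erase j, (x i + y j')) *
      schur (staircase k) (Fin.append ![x i, y j] z)).det * schur (staircase k) z -
    (∏ i, ∏ j ∈ Finset.Ioi i, (x j - x i) * (y j - y i)) *
      schur (staircase k) (Fin.append (Fin.append x y) z) * schur (staircase k) z ^ n

theorem map_detDefect {n m : ℕ} (k : ℕ) (f : R →+* S) (x y : Fin n → R) (z : Fin m → R) :
    f (detDefect k x y z) =
      detDefect k (fun i => f (x i)) (fun i => f (y i)) (fun i => f (z i)) := by
  simp only [detDefect, map_sub, map_mul, map_pow, map_prod, RingHom.map_det, map_schur,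
    map_append f]
  congr 3
  ext i j
  simp only [RingHom.mapMatrix_apply, Matrix.map_apply, Matrix.of_apply, map_mul, map_prod,
    map_add, map_schur_append_pair]

theorem detDefect_eq_zero_iff {K : Type*} [Field K] {n m k : ℕ} (x y : Fin n → K) (z : Fin m → K)
    (hxy : ∀ i j, x i + y j ≠ 0) (hs : schur (staircase k) z ≠ 0) :
    detDefect k x y z = 0 ↔
      (Matrix.of fun i j : Fin n => 1 / (x i + y j) *
        (schur (staircase k) (Fin.append ![x i, y j] z) / schur (staircase k) z)).det =
      (∏ i, ∏ j ∈ Finset.Ioi i, (x j - x i) * (y j - y i)) / (∏ i, ∏ j, (x i + y j)) *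
        (schur (staircase k) (Fin.append (Fin.append x y) z) / schur (staircase k) z) := by
  set A := Matrix.of fun i j : Fin n => 1 / (x i + y j) *
        (schur (staircase k) (Fin.append ![x i, y j] z) / schur (staircase k) z) with hA
  have hB : (Matrix.of fun i j : Fin n => (∏ j' ∈ Finset.univ.erase j, (x i + y j')) *
      schur (staircase k) (Fin.append ![x i, y j] z)) =
      Matrix.of fun i j => ((∏ j', (x i + y j')) * schur (staircase k) z) * A i j := by
    ext i j
    rw [Matrix.of_apply, Matrix.of_apply, hA, Matrix.of_apply,
      ← Finset.prod_erase_mul _ _ (Finset.mem_univ j)]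
    have := hxy i j
    field_simp
  have hP : ∏ i, ∏ j, (x i + y j) ≠ 0 :=
    Finset.prod_ne_zero_iff.2 fun i _ => Finset.prod_ne_zero_iff.2 fun c _ => hxy i c
  have hsn : schur (staircase k) z ^ n ≠ 0 := pow_ne_zero _ hs
  rw [detDefect, hB, Matrix.det_mul_column, Finset.prod_mul_distrib, Finset.prod_const,
    Finset.card_univ, Fintype.card_fin, sub_eq_zero, div_mul_div_comm,
    eq_div_iff (mul_ne_zero hP hs)]
  constructor
  · intro h
    refine mul_right_cancel₀ hsn ?_
    linear_combination h
  · intro h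
    linear_combination schur (staircase k) z ^ n * h

theorem prod_Ioi_eq_prod_pairs {n : ℕ} (f : Fin n → Fin n → R) :
    ∏ i, ∏ j ∈ Finset.Ioi i, f i j = ∏ p : Fin n × Fin n with p.1 < p.2, f p.1 p.2 := by
  rw [Finset.prod_filter, Fintype.prod_prod_type]
  refine Finset.prod_congr rfl fun i _ => ?_
  rw [← Finset.prod_filter]
  congr 1
  ext j
  simp

/-- The common denominator `∏_{i < j} (x_j + x_i) s_{δ(k)}(z) s_{δ(l)}(w)` of the matrix in the
Pfaffian identity. -/
noncomputable def pfDenom {N m m' : ℕ} (k l : ℕ) (x : Fin N → R) (z : Fin m → R)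
    (w : Fin m' → R) : R :=
  (∏ p : Fin N × Fin N with p.1 < p.2, (x p.2 + x p.1)) * schur (staircase k) z *
    schur (staircase l) w

/-- The difference of the two sides of the Pfaffian identity after multiplication by all
denominators; a polynomial in the entries of `x`, `z` and `w`. -/
noncomputable def pfDefect {n m m' : ℕ} (k l : ℕ) (x : Fin (2 * n) → R) (z : Fin m → R)
    (w : Fin m' → R) : R :=
  pfaffian (Matrix.of fun i j : Fin (2 * n) => (x j - x i) *
      (∏ p ∈ (Finset.univ.filter fun p : Fin (2 * n) × Fin (2 * n) => p.1 < p.2).erase (i, j),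
        (x p.2 + x p.1)) *
      schur (staircase k) (Fin.append ![x i, x j] z) *
      schur (staircase l) (Fin.append ![x i, x j] w)) * pfDenom k l x z w -
    pfDenom k l x z w ^ n * ((∏ i, ∏ j ∈ Finset.Ioi i, (x j - x i)) *
      schur (staircase k) (Fin.append x z) * schur (staircase l) (Fin.append x w))

theorem map_pfDefect {n m m' : ℕ} (k l : ℕ) (f : R →+* S) (x : Fin (2 * n) → R)
    (z : Fin m → R) (w : Fin m' → R) :
    f (pfDefect k l x z w) =
      pfDefect k l (fun i => f (x i)) (fun i => f (z i)) (fun i => f (w i)) := by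
  simp only [pfDefect, pfDenom, map_sub, map_mul, map_pow, map_prod, map_add, map_pfaffian,
    map_schur, map_append f]
  congr 3
  ext i j
  simp only [Matrix.map_apply, Matrix.of_apply, map_mul, map_prod, map_sub,
    map_add, map_schur_append_pair]

theorem pfDefect_eq_zero_iff {K : Type*} [Field K] {n m m' k l : ℕ} (x : Fin (2 * n) → K)
    (z : Fin m → K) (w : Fin m' → K) (hx : ∀ i j, i < j → x j + x i ≠ 0)
    (hs : schur (staircase k) z ≠ 0) (hs' : schur (staircase l) w ≠ 0) :
    pfDefect k l x z w = 0 ↔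
      pfaffian (Matrix.of fun i j : Fin (2 * n) => (x j - x i) / (x j + x i) *
        (schur (staircase k) (Fin.append ![x i, x j] z) / schur (staircase k) z) *
        (schur (staircase l) (Fin.append ![x i, x j] w) / schur (staircase l) w)) =
      (∏ i, ∏ j ∈ Finset.Ioi i, (x j - x i) / (x j + x i)) *
        (schur (staircase k) (Fin.append x z) / schur (staircase k) z) *
        (schur (staircase l) (Fin.append x w) / schur (staircase l) w) := by
  set A := Matrix.of fun i j : Fin (2 * n) => (x j - x i) / (x j + x i) *
        (schur (staircase k) (Fin.append ![x i, x j] z) / schur (staircase k) z) *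
        (schur (staircase l) (Fin.append ![x i, x j] w) / schur (staircase l) w) with hA
  have hP : ∏ p : Fin (2 * n) × Fin (2 * n) with p.1 < p.2, (x p.2 + x p.1) ≠ 0 :=
    Finset.prod_ne_zero_iff.2 fun p hp => hx _ _ (Finset.mem_filter.1 hp).2
  have hD : pfDenom k l x z w ≠ 0 := mul_ne_zero (mul_ne_zero hP hs) hs'
  rw [pfDefect, pfaffian_congr (B := Matrix.of fun i j => pfDenom k l x z w * A i j)]
  · rw [pfaffian_const_mul, sub_eq_zero, mul_assoc]
    simp only [Finset.prod_div_distrib, prod_Ioi_eq_prod_pairs fun i j => x j + x i]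
    rw [div_mul_div_comm, div_mul_div_comm, ← pfDenom, eq_div_iff hD]
    exact mul_right_inj' (pow_ne_zero _ hD)
  · intro i j hij
    have hmem : (i, j) ∈ Finset.univ.filter
        fun p : Fin (2 * n) × Fin (2 * n) => p.1 < p.2 := by simpa using hij
    rw [Matrix.of_apply, Matrix.of_apply, hA, Matrix.of_apply, pfDenom,
      ← Finset.prod_erase_mul _ _ hmem]
    have := hx i j hij
    field_simp

end Cleared

/-! ### Specialization of the generic point -/

section Specialization

variable (σ : Type*)

/-- The generic point with coordinates indexed by `σ`: the variables, in the field of rational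
functions over `ℚ` (as the field of fractions of polynomials with integer coefficients). -/
noncomputable def genericPoint (a : σ) : FractionRing (MvPolynomial σ ℤ) :=
  algebraMap (MvPolynomial σ ℤ) _ (MvPolynomial.X a)

variable {σ}

theorem genericPoint_ne_zero (a : σ) : genericPoint σ a ≠ 0 := fun h =>
  MvPolynomial.X_ne_zero a (IsFractionRing.injective _ (FractionRing (MvPolynomial σ ℤ))
    (h.trans (map_zero _).symm))

theorem genericPoint_injective : Function.Injective (genericPoint σ) := fun _ _ h =>
  MvPolynomial.X_injective (IsFractionRing.injective _ (FractionRing (MvPolynomial σ ℤ)) h)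

theorem genericPoint_add_ne_zero (a b : σ) : genericPoint σ a + genericPoint σ b ≠ 0 := by
  intro h
  rw [genericPoint, genericPoint, ← map_add] at h
  have h' := IsFractionRing.injective _ (FractionRing (MvPolynomial σ ℤ))
    (h.trans (map_zero _).symm)
  have := congrArg (MvPolynomial.eval fun _ => (1 : ℤ)) h'
  simp at this

theorem genericPoint_sq_injective : Function.Injective fun a : σ => genericPoint σ a ^ 2 := by
  intro a b h
  have h' : (genericPoint σ a - genericPoint σ b) * (genericPoint σ a + genericPoint σ b) = 0 := by
    linear_combination h
  exact genericPoint_injective (sub_eq_zero.1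
    ((mul_eq_zero.1 h').resolve_right (genericPoint_add_ne_zero a b)))

theorem schur_genericPoint_ne_zero {k m : ℕ} (hk : k ≤ m) (e : Fin m → σ)
    (he : Function.Injective e) :
    schur (staircase k) (fun i => genericPoint σ (e i)) ≠ 0 := by
  have h1 : schur (staircase k) (fun i => genericPoint σ (e i)) =
      algebraMap (MvPolynomial σ ℤ) (FractionRing (MvPolynomial σ ℤ))
        (MvPolynomial.rename e (schurPoly (staircase k) m)) := by
    rw [MvPolynomial.rename_eq_aeval]
    exact (map_schur _ _ _).symm
  have h2 : schurPoly (staircase k) m ≠ 0 := fun h =>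
    map_schurPoly_staircase_ne_zero ℚ hk (by rw [h, map_zero])
  rw [h1]
  intro h
  refine h2 (MvPolynomial.rename_injective e he ?_)
  rw [map_zero]
  exact IsFractionRing.injective _ (FractionRing (MvPolynomial σ ℤ)) (h.trans (map_zero _).symm)

theorem detDefect_eq_zero {R : Type*} [CommRing R] {n m k : ℕ} (hk : k ≤ m) (x y : Fin n → R)
    (z : Fin m → R) : detDefect k x y z = 0 := by
  set P := MvPolynomial (Fin n ⊕ Fin n ⊕ Fin m) ℤ
  have key : detDefect k (fun i => (MvPolynomial.X (Sum.inl i) : P))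
      (fun i => MvPolynomial.X (Sum.inr (Sum.inl i)))
      (fun i => MvPolynomial.X (Sum.inr (Sum.inr i))) = 0 := by
    refine IsFractionRing.injective P (FractionRing P) ?_
    rw [map_zero, map_detDefect]
    change detDefect k (fun i => genericPoint _ (Sum.inl i))
      (fun i => genericPoint _ (Sum.inr (Sum.inl i)))
      (fun i => genericPoint _ (Sum.inr (Sum.inr i))) = 0
    have hs := schur_genericPoint_ne_zero hk
      (fun i : Fin m => (Sum.inr (Sum.inr i) : Fin n ⊕ Fin n ⊕ Fin m))
      (Sum.inr_injective.comp Sum.inr_injective)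
    refine (detDefect_eq_zero_iff _ _ _ (fun _ _ => genericPoint_add_ne_zero _ _) hs).2
      (det_schur_of_generic hk _ _ _ ?_ (fun _ => genericPoint_ne_zero _) hs ?_ ?_ ?_ ?_)
    · exact genericPoint_injective.comp (Sum.inr_injective.comp Sum.inr_injective)
    · exact fun i c => genericPoint_injective.ne (by simp)
    · exact fun i c => genericPoint_injective.ne (by simp)
    · exact genericPoint_sq_injective.comp (Sum.inr_injective.comp Sum.inl_injective)
    · exact fun i j => sub_ne_zero.2 (genericPoint_sq_injective.ne (by simp))
  have h := congrArg (MvPolynomial.aeval (Sum.elim x (Sum.elim y z)) : P →ₐ[ℤ] R).toRingHom key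
  rw [map_zero, map_detDefect] at h
  simpa using h

theorem pfDefect_eq_zero {R : Type*} [CommRing R] {n m m' k l : ℕ} (hk : k ≤ m) (hl : l ≤ m')
    (x : Fin (2 * n) → R) (z : Fin m → R) (w : Fin m' → R) : pfDefect k l x z w = 0 := by
  set P := MvPolynomial (Fin (2 * n) ⊕ Fin m ⊕ Fin m') ℤ
  have key : pfDefect k l (fun i => (MvPolynomial.X (Sum.inl i) : P))
      (fun i => MvPolynomial.X (Sum.inr (Sum.inl i)))
      (fun i => MvPolynomial.X (Sum.inr (Sum.inr i))) = 0 := by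
    refine IsFractionRing.injective P (FractionRing P) ?_
    rw [map_zero, map_pfDefect]
    change pfDefect k l (fun i => genericPoint _ (Sum.inl i))
      (fun i => genericPoint _ (Sum.inr (Sum.inl i)))
      (fun i => genericPoint _ (Sum.inr (Sum.inr i))) = 0
    have hs := schur_genericPoint_ne_zero hk
      (fun i : Fin m => (Sum.inr (Sum.inl i) : Fin (2 * n) ⊕ Fin m ⊕ Fin m'))
      (Sum.inr_injective.comp Sum.inl_injective)
    have hs' := schur_genericPoint_ne_zero hl
      (fun i : Fin m' => (Sum.inr (Sum.inr i) : Fin (2 * n) ⊕ Fin m ⊕ Fin m'))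
      (Sum.inr_injective.comp Sum.inr_injective)
    refine (pfDefect_eq_zero_iff _ _ _ (fun _ _ _ => genericPoint_add_ne_zero _ _) hs hs').2
      (pfaffian_schur_of_generic hk hl _ _ _ ?_ (fun _ => genericPoint_ne_zero _) hs
        ?_ (fun _ => genericPoint_ne_zero _) hs' ?_ ?_ ?_)
    · exact genericPoint_injective.comp (Sum.inr_injective.comp Sum.inl_injective)
    · exact genericPoint_injective.comp (Sum.inr_injective.comp Sum.inr_injective)
    · exact fun i c => genericPoint_injective.ne (by simp)
    · exact fun i c => genericPoint_injective.ne (by simp)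
    · exact genericPoint_sq_injective.comp Sum.inl_injective
  have h := congrArg (MvPolynomial.aeval (Sum.elim x (Sum.elim z w)) : P →ₐ[ℤ] R).toRingHom key
  rw [map_zero, map_pfDefect] at h
  simpa using h

end Specialization

end PfaffianSchur

theorem theorem2 {K : Type*} [Field K] :
    -- the denominators are nonzero polynomials, over `K`
    (∀ k m : ℕ, k ≤ m →
      MvPolynomial.map (Int.castRingHom K)
        (PfaffianSchur.schurPoly (PfaffianSchur.staircase k) m) ≠ 0) ∧
    -- part (1)
    (∀ (n m k : ℕ), k ≤ m → ∀ (x y : Fin n → K) (z : Fin m → K),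
      (∀ i j, x i + y j ≠ 0) →
      PfaffianSchur.schur (PfaffianSchur.staircase k) z ≠ 0 →
      (Matrix.of fun i j : Fin n =>
        1 / (x i + y j) *
          (PfaffianSchur.schur (PfaffianSchur.staircase k) (Fin.append ![x i, y j] z) /
            PfaffianSchur.schur (PfaffianSchur.staircase k) z)).det =
        (∏ i, ∏ j ∈ Finset.Ioi i, (x j - x i) * (y j - y i)) / (∏ i, ∏ j, (x i + y j)) *
          (PfaffianSchur.schur (PfaffianSchur.staircase k) (Fin.append (Fin.append x y) z) /
            PfaffianSchur.schur (PfaffianSchur.staircase k) z)) ∧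
    -- part (2)
    (∀ (n m m' k l : ℕ), k ≤ m → l ≤ m' →
      ∀ (x : Fin (2 * n) → K) (z : Fin m → K) (w : Fin m' → K),
      (∀ i j, i < j → x j + x i ≠ 0) →
      PfaffianSchur.schur (PfaffianSchur.staircase k) z ≠ 0 →
      PfaffianSchur.schur (PfaffianSchur.staircase l) w ≠ 0 →
      PfaffianSchur.pfaffian (Matrix.of fun i j : Fin (2 * n) =>
        (x j - x i) / (x j + x i) *
          (PfaffianSchur.schur (PfaffianSchur.staircase k) (Fin.append ![x i, x j] z) /
            PfaffianSchur.schur (PfaffianSchur.staircase k) z) *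
          (PfaffianSchur.schur (PfaffianSchur.staircase l) (Fin.append ![x i, x j] w) /
            PfaffianSchur.schur (PfaffianSchur.staircase l) w)) =
        (∏ i, ∏ j ∈ Finset.Ioi i, (x j - x i) / (x j + x i)) *
          (PfaffianSchur.schur (PfaffianSchur.staircase k) (Fin.append x z) /
            PfaffianSchur.schur (PfaffianSchur.staircase k) z) *
          (PfaffianSchur.schur (PfaffianSchur.staircase l) (Fin.append x w) /
            PfaffianSchur.schur (PfaffianSchur.staircase l) w)) := by
  refine ⟨fun k m hk => PfaffianSchur.map_schurPoly_staircase_ne_zero K hk,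
    fun n m k hk x y z hxy hs => ?_, fun n m m' k l hk hl x z w hx hs hs' => ?_⟩
  · exact (PfaffianSchur.detDefect_eq_zero_iff x y z hxy hs).1
      (PfaffianSchur.detDefect_eq_zero hk x y z)
  · exact (PfaffianSchur.pfDefect_eq_zero_iff x z w hx hs hs').1
      (PfaffianSchur.pfDefect_eq_zero hk hl x z w)
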